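/- Let $(\Omega,\mathcal A,\mathbb P)$ be a probability space, let $I$ be an arbitrary index set, let $U=(U_i)_{i\in I}$ be a family of random elements on $\Omega$ (the $i$-th one with values in a measurable space $\mathrm{Val}(U_i)$), and let $X,Y,Z$ be random elements on $\Omega$. For a random element $W$ let $\sigma(W)$ denote the $\sigma$-algebra generated by $W$ together with the $\mathbb P$-null sets of $\mathcal A$; for a probability measure $P\sim\mathbb P$ write $P(A\mid Z)=E_P(1_A\mid\sigma(Z))$, and write $X\perp\!\!\!\perp_P Y\mid Z$ if $P(A\mid Z)\,P(B\mid Z)=P(A\cap B\mid Z)$ almost surely for all $A\in\sigma(X)$, $B\in\sigma(Y)$. Let $\Delta^\times$ be the set of probability measures $P$ on $(\Omega,\mathcal A)$ that are mutually absolutely continuous with $\mathbb P$ and for which $(U_i)_{i\in I}$ is an independent family. For $i\in I$ let $\Delta_i^{\times2}$ be the set of pairs $(P,Q)\in\Delta^\times\times\Delta^\times$ such that $Q=f\cdot P$ for some $\sigma(U_i)$-measurable $f:\Omega\to\mathbb R_{>0}$. A random index set is a map $J:\Omega\to\mathfrak P(I)$ that is measurable for the $\sigma$-algebra on $\mathfrak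 P(I)$ generated by the sets $\{K\subseteq I: i\in K\}$, $i\in I$. A $\sigma(Z)$-measurable random index set $J$ is called irrelevant to $X$ given $Z$ if for all $i\in I$, $(P,Q)\in\Delta_i^{\times2}$ and $A\in\sigma(X)$ one has $P(A\mid Z)(\omega)=Q(A\mid Z)(\omega)$ for $\mathbb P$-almost every $\omega\in\{i\in J\}$. Let $\mathcal J(X|Z)$ be the almost sure union of all random index sets irrelevant to $X$ given $Z$, that is, the (almost surely unique) random index set such that, for each $i\in I$, $\{i\in\mathcal J(X|Z)\}$ is the smallest event up to null sets that contains, up to null sets, every event $\{i\in J\}$ with $J$ irrelevant to $X$ given $Z$; define $\mathcal J(Y|Z)$ likewise. If $X\perp\!\!\!\perp_P Y\mid Z$ for all $P\in\Delta^\times$, then $\mathcal J(X|Z)\cup\mathcal J(Y|Z)\overset{\text{a.s.}}{=}I$, that is, for every $i\in I$, $\mathbb P(i\in\mathcal J(X|Z)\cup\mathcal J(Y|Z))=1$. -/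

import Mathlib

open MeasureTheory ProbabilityTheory

namespace StructuralIndependence

noncomputable section

/-! ### Completed generated sigma-algebras -/

/-- The null sets `𝒩 = {N ∈ 𝒜 : μ(N) = 0}` of the reference measure. -/
def nullSets {Ω : Type*} [MeasurableSpace Ω] (μ : Measure Ω) : Set (Set Ω) :=
  {N | MeasurableSet N ∧ μ N = 0}

/-- `σ(X) = σ(X, 𝒩)`: the sigma-algebra generated by the random element `X` together with
the null sets of the reference measure `μ`. -/
abbrev sigma {Ω : Type*} [MeasurableSpace Ω] (μ : Measure Ω)
    {E : Type*} [mE : MeasurableSpace E] (X : Ω → E) : MeasurableSpace Ω :=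
  MeasurableSpace.comap X mE ⊔ MeasurableSpace.generateFrom (nullSets μ)

/-- The completed sigma-algebra of a random element is a sub-sigma-algebra of the ambient one, so
that conditional expectations with respect to it are the genuine ones. -/
theorem sigma_le {Ω : Type*} [mΩ : MeasurableSpace Ω] (μ : Measure Ω)
    {E : Type*} [MeasurableSpace E] {X : Ω → E} (hX : Measurable X) : sigma μ X ≤ mΩ :=
  sup_le hX.comap_le (MeasurableSpace.generateFrom_le fun _ hN => hN.1)

/-- The subfamily `U_K = (U_i)_{i ∈ K}`, as a random element of the product space. -/
def subfamily {Ω I : Type*} {V : I → Type*} (U : (i : I) → Ω → V i) (K : Set I) :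
    Ω → ((k : K) → V k) :=
  fun ω k => U k ω

/-! ### Conditional probability and conditional independence -/

/-- The conditional probability `P(A | Z) = E_P(1_A | σ(Z))`. -/
def condProb {Ω : Type*} [MeasurableSpace Ω] (μ P : Measure Ω)
    {F : Type*} [MeasurableSpace F] (Z : Ω → F) (A : Set Ω) : Ω → ℝ :=
  P[A.indicator (fun _ => (1 : ℝ)) | sigma μ Z]

/-- Conditional independence `X ⊥⊥_P Y | Z`:
`P(A | Z) P(B | Z) = P(A ∩ B | Z)` almost surely for all `A ∈ σ(X)` and `B ∈ σ(Y)`. -/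
def CondIndepGiven {Ω : Type*} [MeasurableSpace Ω] (μ P : Measure Ω)
    {E E' F : Type*} [MeasurableSpace E] [MeasurableSpace E'] [MeasurableSpace F]
    (X : Ω → E) (Y : Ω → E') (Z : Ω → F) : Prop :=
  ∀ A B : Set Ω, MeasurableSet[sigma μ X] A → MeasurableSet[sigma μ Y] B →
    ∀ᵐ ω ∂P, condProb μ P Z A ω * condProb μ P Z B ω = condProb μ P Z (A ∩ B) ω

/-! ### Product probability measures -/

/-- `Δ^×`: the probability measures `P ∼ μ` for which `(U_i)` is an independent family. -/
def productMeasures {Ω : Type*} [MeasurableSpace Ω] (μ : Measure Ω)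
    {I : Type*} {V : I → Type*} [∀ i, MeasurableSpace (V i)] (U : (i : I) → Ω → V i) :
    Set (Measure Ω) :=
  {P | IsProbabilityMeasure P ∧ iIndepFun U P ∧ P ≪ μ ∧ μ ≪ P}

/-- `Δ_K^{×2}`: the pairs `(P, Q)` in `Δ^× × Δ^×` such that `Q = f · P` for some positive
`σ(U_K)`-measurable `f : Ω → ℝ`. -/
def productPairs {Ω : Type*} [MeasurableSpace Ω] (μ : Measure Ω)
    {I : Type*} {V : I → Type*} [∀ i, MeasurableSpace (V i)] (U : (i : I) → Ω → V i)
    (K : Set I) : Set (Measure Ω × Measure Ω) :=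
  {PQ | PQ.1 ∈ productMeasures μ U ∧ PQ.2 ∈ productMeasures μ U ∧
    ∃ f : Ω → ℝ, (∀ ω, 0 < f ω) ∧ Measurable[sigma μ (subfamily U K)] f ∧
      PQ.2 = PQ.1.withDensity (fun ω => ENNReal.ofReal (f ω))}

/-! ### Almost sure relations and almost sure unions -/

/-- Almost sure inclusion of sets. -/
def AsSubset {Ω : Type*} [MeasurableSpace Ω] (μ : Measure Ω) (A B : Set Ω) : Prop :=
  μ (A \ B) = 0

/-- Almost sure inclusion of random index sets, required for each index separately. -/
def AsSubsetIndex {Ω : Type*} [MeasurableSpace Ω] (μ : Measure Ω) {I : Type*}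
    (J K : Ω → Set I) : Prop :=
  ∀ i, AsSubset μ {ω | i ∈ J ω} {ω | i ∈ K ω}

/-- Almost sure equality of random index sets. -/
def AsEqIndex {Ω : Type*} [MeasurableSpace Ω] (μ : Measure Ω) {I : Type*}
    (J K : Ω → Set I) : Prop :=
  AsSubsetIndex μ J K ∧ AsSubsetIndex μ K J

/-- `B` is (a version of) the almost sure union of the family of events `A`: the almost surely
smallest event that almost surely contains every `A s`. -/
structure IsAsUnion {Ω : Type*} [MeasurableSpace Ω] (μ : Measure Ω) {S : Type*}
    (A : S → Set Ω) (B : Set Ω) : Prop where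
  measurableSet : MeasurableSet B
  subset : ∀ s, AsSubset μ (A s) B
  minimal : ∀ C, MeasurableSet C → (∀ s, AsSubset μ (A s) C) → AsSubset μ B C

/-- `M` is (a version of) the almost sure union of the random index sets `J s`. -/
def IsAsUnionIndex {Ω : Type*} [MeasurableSpace Ω] (μ : Measure Ω) {I S : Type*}
    (J : S → Ω → Set I) (M : Ω → Set I) : Prop :=
  ∀ i, IsAsUnion μ (fun s => {ω | i ∈ J s ω}) {ω | i ∈ M ω}

/-! ### Irrelevance -/

/-- The `σ(Z)`-measurable random index set `J` is irrelevant to `X` given `Z`. Here the powerset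
of `I` carries the sigma-algebra generated by the sets `{K | i ∈ K}`, `i ∈ I`. -/
structure IsIrrelevant {Ω : Type*} [MeasurableSpace Ω] (μ : Measure Ω)
    {I : Type*} {V : I → Type*} [∀ i, MeasurableSpace (V i)] (U : (i : I) → Ω → V i)
    {E F : Type*} [MeasurableSpace E] [MeasurableSpace F]
    (X : Ω → E) (Z : Ω → F) (J : Ω → Set I) : Prop where
  measurable : Measurable[sigma μ Z] J
  condProb_eq : ∀ i, ∀ P Q : Measure Ω, (P, Q) ∈ productPairs μ U {i} →
    ∀ A, MeasurableSet[sigma μ X] A →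
      ∀ᵐ ω ∂μ, i ∈ J ω → condProb μ P Z A ω = condProb μ Q Z A ω

/-- `M` is (a version of) `𝒥(X | Z)`, the random index set of irrelevance for `X` given `Z`: the
almost sure union of all random index sets that are irrelevant to `X` given `Z`. -/
def IsIrrelevance {Ω : Type*} [MeasurableSpace Ω] (μ : Measure Ω)
    {I : Type*} {V : I → Type*} [∀ i, MeasurableSpace (V i)] (U : (i : I) → Ω → V i)
    {E F : Type*} [MeasurableSpace E] [MeasurableSpace F]
    (X : Ω → E) (Z : Ω → F) (M : Ω → Set I) : Prop :=
  IsAsUnionIndex μ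
    (fun J : {J : Ω → Set I // IsIrrelevant μ U X Z J} => (J : Ω → Set I)) M

/-! ### Existence of almost sure unions, so that `𝒥(X | Z)` always has a version -/

theorem exists_isAsUnion {Ω : Type*} [MeasurableSpace Ω] (μ : Measure Ω) [IsFiniteMeasure μ]
    {S : Type*} (A : S → Set Ω) (hA : ∀ s, MeasurableSet (A s)) : ∃ B, IsAsUnion μ A B := by
  let T : Set ENNReal := {p | ∃ c : Set S, c.Countable ∧ p = μ (⋃ s ∈ c, A s)}
  have hT : T.Nonempty := ⟨_, ∅, Set.countable_empty, rfl⟩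
  obtain ⟨u, -, hu, huT⟩ := exists_seq_tendsto_sSup hT (OrderTop.bddAbove T)
  choose c hc huc using huT
  let d : Set S := ⋃ n, c n
  have hd : d.Countable := Set.countable_iUnion hc
  have hm : ∀ e : Set S, e.Countable → MeasurableSet (⋃ s ∈ e, A s) := fun e he =>
    MeasurableSet.biUnion he fun s _ => hA s
  have hsup : sSup T ≤ μ (⋃ s ∈ d, A s) := by
    refine le_of_tendsto' hu fun n => ?_
    rw [huc n]
    exact measure_mono (Set.biUnion_subset_biUnion_left (Set.subset_iUnion c n))
  refine ⟨⋃ s ∈ d, A s, hm d hd, fun s => ?_, fun C _ hAC => ?_⟩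
  · have h1 : μ (⋃ t ∈ insert s d, A t) ≤ μ (⋃ t ∈ d, A t) :=
      (le_sSup ⟨insert s d, hd.insert s, rfl⟩ : _ ≤ sSup T).trans hsup
    rw [Set.biUnion_insert, Set.union_comm, ← Set.union_sdiff_self,
      measure_union Set.disjoint_sdiff_right ((hA s).diff (hm d hd))] at h1
    have h2 : μ (⋃ t ∈ d, A t) + μ (A s \ ⋃ t ∈ d, A t) ≤ μ (⋃ t ∈ d, A t) + 0 := by
      simpa using h1
    exact le_antisymm ((ENNReal.add_le_add_iff_left (measure_ne_top _ _)).1 h2) zero_le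
  · unfold AsSubset
    simp only [Set.iUnion_sdiff]
    exact (measure_biUnion_null_iff hd).2 fun s _ => hAC s

theorem exists_isIrrelevance {Ω : Type*} [MeasurableSpace Ω] (μ : Measure Ω) [IsFiniteMeasure μ]
    {I : Type*} {V : I → Type*} [∀ i, MeasurableSpace (V i)] (U : (i : I) → Ω → V i)
    {E F : Type*} [MeasurableSpace E] [MeasurableSpace F]
    (X : Ω → E) {Z : Ω → F} (hZ : Measurable Z) : ∃ M : Ω → Set I, IsIrrelevance μ U X Z M := by
  have h : ∀ i : I, ∃ B : Set Ω, IsAsUnion μ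
      (fun J : {J : Ω → Set I // IsIrrelevant μ U X Z J} => {ω | i ∈ (J : Ω → Set I) ω}) B :=
    fun i => exists_isAsUnion μ _ fun J =>
      measurableSet_setOfPred.2 (measurable_set_iff.1 (J.2.measurable.mono (sigma_le μ hZ) le_rfl) i)
  choose B hB using h
  exact ⟨fun ω => {i | ω ∈ B i}, hB⟩

end

end StructuralIndependence

/-! Fix `i`. It suffices that two changes `(P, Q)`, `(P', Q')` of the law of `U i` cannot, at the
same point, move the conditional probability of some `A ∈ σ(X)` and that of some `B ∈ σ(Y)`
(`condProb_eq_or_condProb_eq`). The events of `Z` where `X` is affected and those where `Y` is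
affected then have almost surely disjoint unions, and the complement of each union lies in the
corresponding index set of irrelevance.

The algebraic core is `det_mul_det_eq_zero`. If four densities have pairwise midpoints that are
again product densities, conditional independence under the midpoints forces, for every pair, equal
conditional probabilities of `A` or equal ones of `B`. Two equivalence relations that together
relate all pairs cannot both be proper, so `A` does not separate the first two densities or `B` does
not separate the last two.

Relative to `P`, the measures `P, Q, P', Q'` have densities `1, b, φ, c * φ`, whose midpoints are in
general not product densities. If `φ` is a neutral factor times finitely many factors `f j`, a path
deforms this common part from `1` to its final form. At each interior parameter only the factor in
coordinate `i` distinguishes the four densities, so the core applies. The determinants are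
polynomials in the parameter, hence one of them vanishes identically, and the `A`-determinant may be
read off at `0` and the `B`-determinant at `1` (`condDet_path_eq_zero`).

A general `φ` is the mean limit of a fixed neutral factor times the finite products of its marginal
densities, by convergence of conditional expectations (`tendsto_eLpNorm_neutral_mul_prod`); the
vanishing product of determinants survives the limit. -/

namespace StructuralIndependence

/-! ### Product densities and neutral densities -/

section Densities

variable {Ω I : Type*}

open scoped ENNReal

theorem iIndep_mono {mΩ : MeasurableSpace Ω}
    {m m' : I → MeasurableSpace Ω} {P : Measure Ω} (h : iIndep m P)
    (hle : ∀ j, m' j ≤ m j) : iIndep m' P := by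
  rw [iIndep_iff] at h ⊢
  exact fun s f hf => h s fun i hi => hle i _ (hf i hi)

theorem iIndep_congr_iSup {mΩ : MeasurableSpace Ω}
    {m : I → MeasurableSpace Ω} {P Q : Measure Ω} (h : iIndep m P)
    (hPQ : ∀ A, MeasurableSet[⨆ j, m j] A → Q A = P A) : iIndep m Q := by
  rw [iIndep_iff] at h ⊢
  intro s f hf
  have hf' : ∀ i ∈ s, MeasurableSet[⨆ j, m j] (f i) := fun i hi => le_iSup m i _ (hf i hi)
  have hI : MeasurableSet[⨆ j, m j] (⋂ i ∈ s, f i) :=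
    @Finset.measurableSet_biInter _ _ (⨆ j, m j) _ s hf'
  rw [hPQ _ hI, h s hf]
  exact Finset.prod_congr rfl fun i hi => (hPQ _ (hf' i hi)).symm

/-- On a cylinder the density and the indicator factor together over the coordinates, so
independence under `P` splits the integral. Padding with `f' j = 1` off `K` and `A' i = univ` off
`S` lets both products run over `S ∪ K`. -/
theorem iIndep_withDensity_prod {mΩ : MeasurableSpace Ω}
    {m : I → MeasurableSpace Ω} (hm : ∀ j, m j ≤ mΩ) {P : Measure Ω}
    (h : iIndep m P) {f : I → Ω → ℝ≥0∞} (hf : ∀ j, Measurable[m j] (f j))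
    (h1 : ∀ j, ∫⁻ ω, f j ω ∂P = 1) (K : Finset I) :
    iIndep m (P.withDensity fun ω => ∏ j ∈ K, f j ω) ∧
      ∀ j ∈ K, ∀ A, MeasurableSet[m j] A →
        P.withDensity (fun ω => ∏ j ∈ K, f j ω) A = ∫⁻ ω in A, f j ω ∂P := by
  classical
  have := h.isProbabilityMeasure
  let f' : I → Ω → ℝ≥0∞ := fun j => if j ∈ K then f j else 1
  have hf' : ∀ j, Measurable[m j] (f' j) := by
    intro j
    by_cases hj : j ∈ K
    · simpa [f', hj] using hf j
    · simp only [f', hj, if_false]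
      exact measurable_const
  have h1' : ∀ j, ∫⁻ ω, f' j ω ∂P = 1 := by
    intro j
    by_cases hj : j ∈ K
    · simpa [f', hj] using h1 j
    · simp [f', hj]
  have key : ∀ (S : Finset I) (A : I → Set Ω), (∀ i ∈ S, MeasurableSet[m i] (A i)) →
      P.withDensity (fun ω => ∏ j ∈ K, f j ω) (⋂ i ∈ S, A i) = ∏ i ∈ S, ∫⁻ ω in A i, f' i ω ∂P := by
    intro S A hA
    have hAm : MeasurableSet (⋂ i ∈ S, A i) :=
      MeasurableSet.biInter S.countable_toSet fun i hi => hm i _ (hA i hi)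
    let A' : I → Set Ω := fun i => if i ∈ S then A i else Set.univ
    have hA' : ∀ i, MeasurableSet[m i] (A' i) := by
      intro i
      by_cases hi : i ∈ S
      · simpa [A', hi] using hA i hi
      · simp [A', hi]
    have hX : ∀ i, Measurable[m i] ((A' i).indicator (f' i)) := fun i => (hf' i).indicator (hA' i)
    have hind : iIndepFun (fun i => (A' i).indicator (f' i)) P :=
      iIndep_mono h fun i => (hX i).comap_le
    have := lintegral_prod_eq_prod_lintegral_of_indepFun (S ∪ K) _ hind
      fun i => (hX i).mono (hm i) le_rfl
    rw [withDensity_apply _ hAm, ← lintegral_indicator hAm]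
    trans ∫⁻ ω, ∏ i ∈ S ∪ K, (A' i).indicator (f' i) ω ∂P
    · congr 1
      ext ω
      by_cases hω : ω ∈ ⋂ i ∈ S, A i
      · rw [Set.indicator_of_mem hω]
        have hω' : ∀ i, ω ∈ A' i := by
          intro i
          by_cases hi : i ∈ S
          · simpa [A', hi] using Set.mem_iInter₂.1 hω i hi
          · simp [A', hi]
        simp only [Set.indicator_of_mem (hω' _)]
        rw [← Finset.prod_subset (Finset.subset_union_right : K ⊆ S ∪ K)]
        · exact Finset.prod_congr rfl fun i hi => by simp [f', hi]
        · exact fun i _ hi => by simp [f', hi]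
      · rw [Set.indicator_of_notMem hω]
        simp only [Set.mem_iInter, not_forall] at hω
        obtain ⟨i, hi, hωi⟩ := hω
        refine (Finset.prod_eq_zero (Finset.mem_union_left K hi) ?_).symm
        exact Set.indicator_of_notMem (by simpa [A', hi] using hωi) _
    · rw [this, ← Finset.prod_subset (Finset.subset_union_left : S ⊆ S ∪ K)]
      · refine Finset.prod_congr rfl fun i hi => ?_
        rw [lintegral_indicator (hm i _ (hA' i))]
        simp [A', hi]
      · intro i _ hi
        simp [A', hi, h1']
  have single : ∀ j, ∀ A, MeasurableSet[m j] A →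
        P.withDensity (fun ω => ∏ j ∈ K, f j ω) A = ∫⁻ ω in A, f' j ω ∂P := by
    intro j A hA
    simpa using key {j} (fun _ => A) (by simpa using hA)
  refine ⟨?_, fun j hj A hA => ?_⟩
  · rw [iIndep_iff]
    intro S A hA
    rw [key S A hA]
    exact Finset.prod_congr rfl fun i hi => (single i _ (hA i hi)).symm
  · rw [single j A hA]
    simp [f', hj]

/-- Two measures under which the family `m` is independent and which agree on every `m j`, `j ∈ K`,
agree on the sigma-algebra generated by these. -/
theorem eq_on_biSup_of_iIndep {mΩ : MeasurableSpace Ω}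
    {m : I → MeasurableSpace Ω} (hm : ∀ j, m j ≤ mΩ) {P Q : Measure Ω}
    (hP : iIndep m P) (hQ : iIndep m Q) {K : Set I}
    (h : ∀ j ∈ K, ∀ A, MeasurableSet[m j] A → P A = Q A) {A : Set Ω}
    (hA : MeasurableSet[⨆ j ∈ K, m j] A) : P A = Q A := by
  have := hP.isProbabilityMeasure
  have := hQ.isProbabilityMeasure
  have hle : ⨆ j ∈ K, m j ≤ mΩ := iSup₂_le fun j _ => hm j
  refine MeasurableSpace.induction_on_inter
    (C := fun A _ => P A = Q A) (generateFrom_piiUnionInter_measurableSet m K).symm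
    (isPiSystem_piiUnionInter _ (fun j => (m j).isPiSystem_measurableSet) K) ?_ ?_ ?_ ?_ A hA
  · simp
  · rintro B ⟨S, hS, f, hf, rfl⟩
    rw [hP.meas_biInter fun i hi => hf i hi, hQ.meas_biInter fun i hi => hf i hi]
    exact Finset.prod_congr rfl fun i hi => h i (hS hi) _ (hf i hi)
  · intro B hB hPQ
    rw [prob_compl_eq_one_sub (hle _ hB), prob_compl_eq_one_sub (hle _ hB), hPQ]
  · intro f hd hf hPQ
    rw [measure_iUnion hd fun i => hle _ (hf i), measure_iUnion hd fun i => hle _ (hf i)]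
    simp [hPQ]

/-- The measure with real density `ρ` with respect to `P`. -/
noncomputable abbrev tilt {mΩ : MeasurableSpace Ω} (P : Measure Ω) (ρ : Ω → ℝ) : Measure Ω :=
  P.withDensity fun ω => ENNReal.ofReal (ρ ω)

/-- A positive density with respect to `P` under which the family `m` is independent. -/
structure IsProductDensity {mΩ : MeasurableSpace Ω}
    (m : I → MeasurableSpace Ω) (P : Measure Ω) (ρ : Ω → ℝ) : Prop where
  measurable : Measurable ρ
  pos : ∀ ω, 0 < ρ ω
  indep : iIndep m (tilt P ρ)

/-- A positive density of total mass one that is measurable for the sigma-algebra `n`. -/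
structure IsDensity (n : MeasurableSpace Ω) {mΩ : MeasurableSpace Ω}
    (P : Measure Ω) (f : Ω → ℝ) : Prop where
  measurable : Measurable[n] f
  pos : ∀ ω, 0 < f ω
  lintegral_eq : ∫⁻ ω, ENNReal.ofReal (f ω) ∂P = 1

theorem IsDensity.one {n mΩ : MeasurableSpace Ω} {P : Measure Ω} [IsProbabilityMeasure P] :
    IsDensity n P fun _ => 1 :=
  ⟨measurable_const, fun _ => one_pos, by simp⟩

theorem IsDensity.convex {n mΩ : MeasurableSpace Ω} (hn : n ≤ mΩ) {P : Measure Ω} {f g : Ω → ℝ}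
    (hf : IsDensity n P f) (hg : IsDensity n P g) {s : ℝ} (hs0 : 0 < s) (hs1 : s < 1) :
    IsDensity n P fun ω => (1 - s) * f ω + s * g ω where
  measurable := (hf.measurable.const_mul _).add (hg.measurable.const_mul _)
  pos ω := add_pos (mul_pos (sub_pos.2 hs1) (hf.pos ω)) (mul_pos hs0 (hg.pos ω))
  lintegral_eq := by
    have h1 : ∀ ω, ENNReal.ofReal ((1 - s) * f ω + s * g ω) =
        ENNReal.ofReal (1 - s) * ENNReal.ofReal (f ω) +
          ENNReal.ofReal s * ENNReal.ofReal (g ω) := fun ω => by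
      rw [ENNReal.ofReal_add (mul_pos (sub_pos.2 hs1) (hf.pos ω)).le (mul_pos hs0 (hg.pos ω)).le,
        ENNReal.ofReal_mul (sub_pos.2 hs1).le, ENNReal.ofReal_mul hs0.le]
    have hfm := hf.measurable.mono hn le_rfl
    have hgm := hg.measurable.mono hn le_rfl
    simp only [h1]
    rw [lintegral_add_left (by fun_prop), lintegral_const_mul _ (by fun_prop),
      lintegral_const_mul _ (by fun_prop), hf.lintegral_eq, hg.lintegral_eq, mul_one, mul_one,
      ← ENNReal.ofReal_add (sub_pos.2 hs1).le hs0.le]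
    simp

theorem IsDensity.integrable {n mΩ : MeasurableSpace Ω} (hn : n ≤ mΩ) {P : Measure Ω} {f : Ω → ℝ}
    (hf : IsDensity n P f) : Integrable f P := by
  refine ⟨(hf.measurable.mono hn le_rfl).aestronglyMeasurable, ?_⟩
  rw [hasFiniteIntegral_iff_ofReal (Filter.Eventually.of_forall fun ω => (hf.pos ω).le),
    hf.lintegral_eq]
  exact ENNReal.one_lt_top

theorem IsProductDensity.isDensity {mΩ : MeasurableSpace Ω}
    {m : I → MeasurableSpace Ω} {P : Measure Ω} {ρ : Ω → ℝ}
    (h : IsProductDensity m P ρ) : IsDensity mΩ P ρ := by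
  refine ⟨h.measurable, h.pos, ?_⟩
  have := h.indep.isProbabilityMeasure
  have h1 : tilt P ρ Set.univ = 1 := measure_univ
  rwa [withDensity_apply _ MeasurableSet.univ, setLIntegral_univ] at h1

theorem IsProductDensity.integrable {mΩ : MeasurableSpace Ω}
    {m : I → MeasurableSpace Ω} {P : Measure Ω} {ρ : Ω → ℝ}
    (h : IsProductDensity m P ρ) : Integrable ρ P :=
  h.isDensity.integrable le_rfl

/-- A positive density that does not change the measure on the sigma-algebra `n`. -/
structure IsNeutralDensity (n : MeasurableSpace Ω) {mΩ : MeasurableSpace Ω}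
    (P : Measure Ω) (ψ : Ω → ℝ) : Prop where
  measurable : Measurable ψ
  pos : ∀ ω, 0 < ψ ω
  tilt_eq : ∀ A, MeasurableSet[n] A → tilt P ψ A = P A

theorem IsNeutralDensity.one {n mΩ : MeasurableSpace Ω} {P : Measure Ω} :
    IsNeutralDensity n P fun _ => 1 :=
  ⟨measurable_const, fun _ => one_pos, fun A _ => by simp [tilt]⟩

theorem IsNeutralDensity.convex {n mΩ : MeasurableSpace Ω} (hn : n ≤ mΩ) {P : Measure Ω} {ψ : Ω → ℝ}
    (hψ : IsNeutralDensity n P ψ) {s : ℝ} (hs0 : 0 < s) (hs1 : s < 1) :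
    IsNeutralDensity n P fun ω => (1 - s) + s * ψ ω where
  measurable := (hψ.measurable.const_mul _).const_add _
  pos ω := add_pos (sub_pos.2 hs1) (mul_pos hs0 (hψ.pos ω))
  tilt_eq A hA := by
    have h1 : ∀ ω, ENNReal.ofReal ((1 - s) + s * ψ ω) =
        ENNReal.ofReal (1 - s) + ENNReal.ofReal s * ENNReal.ofReal (ψ ω) := fun ω => by
      rw [ENNReal.ofReal_add (sub_pos.2 hs1).le (mul_pos hs0 (hψ.pos ω)).le,
        ENNReal.ofReal_mul hs0.le]
    have hm := hψ.measurable
    have h2 := hψ.tilt_eq A hA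
    rw [tilt, withDensity_apply _ (hn _ hA)] at h2 ⊢
    simp only [h1]
    rw [lintegral_add_left measurable_const, lintegral_const_mul _ (by fun_prop), h2,
      setLIntegral_const, ← add_mul, ← ENNReal.ofReal_add (sub_pos.2 hs1).le hs0.le]
    simp

theorem IsNeutralDensity.lintegral_mul {n mΩ : MeasurableSpace Ω} (hn : n ≤ mΩ) {P : Measure Ω}
    {ψ : Ω → ℝ} (hψ : IsNeutralDensity n P ψ) {g : Ω → ℝ≥0∞} (hg : Measurable[n] g) :
    ∫⁻ ω, ENNReal.ofReal (ψ ω) * g ω ∂P = ∫⁻ ω, g ω ∂P := by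
  have hm := hψ.measurable
  have h : (tilt P ψ).trim hn = P.trim hn := by
    refine @Measure.ext _ n _ _ fun A hA => ?_
    rw [trim_measurableSet_eq hn hA, trim_measurableSet_eq hn hA, hψ.tilt_eq A hA]
  rw [← lintegral_trim hn hg, ← h, lintegral_trim hn hg,
    lintegral_withDensity_eq_lintegral_mul _ (by fun_prop) (hg.mono hn le_rfl)]
  rfl

/-- A neutral density times a finite product of densities, one for each `m j`, is a product
density. -/
theorem isProductDensity_mul_prod {mΩ : MeasurableSpace Ω}
    {m : I → MeasurableSpace Ω} (hm : ∀ j, m j ≤ mΩ)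
    {P : Measure Ω} (h : iIndep m P) {ψ : Ω → ℝ} (hψ : IsNeutralDensity (⨆ j, m j) P ψ)
    {f : I → Ω → ℝ} (hf : ∀ j, IsDensity (m j) P (f j)) (K : Finset I) :
    IsProductDensity m P fun ω => ψ ω * ∏ j ∈ K, f j ω := by
  have hfm : ∀ j, Measurable (f j) := fun j => (hf j).measurable.mono (hm j) le_rfl
  have hψm := hψ.measurable
  refine ⟨hψm.mul (Finset.measurable_prod _ fun j _ => hfm j),
    fun ω => mul_pos (hψ.pos ω) (Finset.prod_pos fun j _ => (hf j).pos ω), ?_⟩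
  have hsup : ⨆ j, m j ≤ mΩ := iSup_le hm
  have h0 : iIndep m (tilt P ψ) := iIndep_congr_iSup h hψ.tilt_eq
  have hfe : ∀ j, Measurable[m j] fun ω => ENNReal.ofReal (f j ω) := fun j =>
    ENNReal.measurable_ofReal.comp (hf j).measurable
  have h1 := (iIndep_withDensity_prod hm h0 (f := fun j ω => ENNReal.ofReal (f j ω)) hfe
    (fun j => by
      rw [lintegral_withDensity_eq_lintegral_mul _ (by fun_prop) ((hfe j).mono (hm j) le_rfl)]
      exact (hψ.lintegral_mul hsup ((hfe j).mono (le_iSup m j) le_rfl)).trans (hf j).lintegral_eq)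
    K).1
  rw [tilt, ← withDensity_mul _ (by fun_prop) (by fun_prop)] at h1
  convert h1 using 2
  ext ω
  rw [Pi.mul_apply, ENNReal.ofReal_mul (hψ.pos ω).le,
    ENNReal.ofReal_prod_of_nonneg fun j _ => ((hf j).pos ω).le]

end Densities

/-! ### Determinants of conditional weights and the polynomial path -/

section ConditionalExpectations

variable {Ω I : Type*}

open scoped ENNReal Polynomial

/-- The conditional expectation `E_P(ρ 1_A | 𝒢)`. -/
noncomputable def condWeight (𝒢 : MeasurableSpace Ω) {mΩ : MeasurableSpace Ω} (P : Measure Ω)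
    (ρ : Ω → ℝ) (A : Set Ω) : Ω → ℝ :=
  P[fun ω => ρ ω * A.indicator (fun _ => (1 : ℝ)) ω | 𝒢]

theorem integrable_mul_indicator_one {mΩ : MeasurableSpace Ω} {P : Measure Ω} {ρ : Ω → ℝ}
    (hρ : Integrable ρ P) {A : Set Ω} (hA : MeasurableSet A) :
    Integrable (fun ω => ρ ω * A.indicator (fun _ => (1 : ℝ)) ω) P := by
  refine (hρ.indicator hA).congr (Filter.Eventually.of_forall fun ω => ?_)
  by_cases h : ω ∈ A <;> simp [h]

theorem condWeight_sum {ι : Type*} {𝒢 mΩ : MeasurableSpace Ω} {P : Measure Ω} {A : Set Ω}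
    (hA : MeasurableSet A) (s : Finset ι) (c : ι → ℝ) {u : ι → Ω → ℝ}
    (hu : ∀ k ∈ s, Integrable (u k) P) :
    condWeight 𝒢 P (fun ω => ∑ k ∈ s, c k * u k ω) A =ᵐ[P]
      fun ω => ∑ k ∈ s, c k * condWeight 𝒢 P (u k) A ω := by
  have h1 : (fun ω => (∑ k ∈ s, c k * u k ω) * A.indicator (fun _ => (1 : ℝ)) ω) =
      ∑ k ∈ s, c k • fun ω => u k ω * A.indicator (fun _ => (1 : ℝ)) ω := by
    ext ω
    simp [Finset.sum_mul, mul_assoc]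
  rw [condWeight, h1]
  have h2 : ∀ᵐ ω ∂P, ∀ k ∈ s, (P[c k • fun ω => u k ω * A.indicator (fun _ => (1 : ℝ)) ω | 𝒢]) ω =
      c k * condWeight 𝒢 P (u k) A ω := by
    rw [Filter.eventually_all_finset]
    exact fun k _ => condExp_smul (c k) _ 𝒢
  filter_upwards [condExp_finsetSum (fun k hk =>
    (integrable_mul_indicator_one (hu k hk) hA).smul (c k)) 𝒢, h2] with ω hω h2ω
  rw [hω, Finset.sum_apply]
  exact Finset.sum_congr rfl h2ω

/-- The set where the conditional expectation is nonpositive belongs to `𝒢`, so `ρ` has nonpositive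
integral over it; as `ρ > 0`, that set is null. -/
theorem condExp_pos_of_pos {𝒢 mΩ : MeasurableSpace Ω} (h𝒢 : 𝒢 ≤ mΩ) {P : Measure Ω}
    [IsProbabilityMeasure P] {ρ : Ω → ℝ} (hρ : Integrable ρ P) (hpos : ∀ ω, 0 < ρ ω) :
    ∀ᵐ ω ∂P, 0 < (P[ρ | 𝒢]) ω := by
  have hS : MeasurableSet[𝒢] {ω | (P[ρ | 𝒢]) ω ≤ 0} :=
    measurableSet_le stronglyMeasurable_condExp.measurable measurable_const
  have h1 := setIntegral_condExp h𝒢 hρ hS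
  have h2 : ∫ ω in {ω | (P[ρ | 𝒢]) ω ≤ 0}, (P[ρ | 𝒢]) ω ∂P ≤ 0 :=
    setIntegral_nonpos (h𝒢 _ hS) fun ω hω => hω
  have h3 := (setIntegral_pos_iff_support_of_nonneg_ae
    (Filter.Eventually.of_forall fun ω => (hpos ω).le) hρ.integrableOn
    (s := {ω | (P[ρ | 𝒢]) ω ≤ 0})).not.1 (by rw [← h1]; exact not_lt.2 h2)
  have h4 : Function.support ρ = Set.univ := by
    ext ω
    simp [(hpos ω).ne']
  rw [h4, Set.univ_inter, not_lt, nonpos_iff_eq_zero] at h3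
  rw [ae_iff]
  simpa only [not_lt] using h3

theorem condWeight_univ_pos {𝒢 mΩ : MeasurableSpace Ω} (h𝒢 : 𝒢 ≤ mΩ) {P : Measure Ω}
    [IsProbabilityMeasure P] {ρ : Ω → ℝ} (hρ : Integrable ρ P) (hpos : ∀ ω, 0 < ρ ω) :
    ∀ᵐ ω ∂P, 0 < condWeight 𝒢 P ρ Set.univ ω := by
  simpa [condWeight] using condExp_pos_of_pos h𝒢 hρ hpos

/-- The conditional expectation with respect to `ρ · P` in terms of that with respect to `P`. -/
theorem condExp_tilt_mul {𝒢 mΩ : MeasurableSpace Ω} (h𝒢 : 𝒢 ≤ mΩ) {P : Measure Ω}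
    [IsProbabilityMeasure P] {ρ : Ω → ℝ} (hρ : IsDensity mΩ P ρ) {A : Set Ω}
    (hA : MeasurableSet A) :
    ∀ᵐ ω ∂P, ((tilt P ρ)[A.indicator (fun _ => (1 : ℝ)) | 𝒢]) ω * condWeight 𝒢 P ρ Set.univ ω =
      condWeight 𝒢 P ρ A ω := by
  have hprob : IsProbabilityMeasure (tilt P ρ) := ⟨by
    rw [tilt, withDensity_apply _ MeasurableSet.univ, setLIntegral_univ, hρ.lintegral_eq]⟩
  have hρm := hρ.measurable
  have hint : ∀ (g : Ω → ℝ) (S : Set Ω), MeasurableSet S →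
      ∫ ω in S, g ω ∂(tilt P ρ) = ∫ ω in S, ρ ω * g ω ∂P := by
    intro g S hS
    rw [tilt, setIntegral_withDensity_eq_setIntegral_toReal_smul (by fun_prop)
      (Filter.Eventually.of_forall fun _ => ENNReal.ofReal_lt_top) _ hS]
    simp [ENNReal.toReal_ofReal (hρ.pos _).le]
  have hi1 : Integrable (A.indicator fun _ => (1 : ℝ)) (tilt P ρ) :=
    (integrable_const _).indicator hA
  set q := (tilt P ρ)[A.indicator (fun _ => (1 : ℝ)) | 𝒢] with hq
  have hqm : StronglyMeasurable[𝒢] q := stronglyMeasurable_condExp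
  have hqi : Integrable (fun ω => ρ ω * q ω) P := by
    have h1 : Integrable q (tilt P ρ) := integrable_condExp
    rw [tilt, integrable_withDensity_iff_integrable_smul' (by fun_prop)
      (Filter.Eventually.of_forall fun _ => ENNReal.ofReal_lt_top)] at h1
    simpa [ENNReal.toReal_ofReal (hρ.pos _).le] using h1
  have hρi := hρ.integrable le_rfl
  -- Both `ρ * q` and `ρ * 1_A` have the same integrals over sets of `𝒢`, since these are integrals
  -- of `q` and `1_A` against `tilt P ρ`. Pulling the `𝒢`-measurable `q` out then gives the claim.
  have h1 : P[fun ω => ρ ω * q ω | 𝒢] =ᵐ[P] condWeight 𝒢 P ρ A := by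
    refine ae_eq_condExp_of_forall_setIntegral_eq h𝒢 (integrable_mul_indicator_one hρi hA)
      (fun S _ _ => integrable_condExp.integrableOn) (fun S hS _ => ?_)
      stronglyMeasurable_condExp.aestronglyMeasurable
    rw [setIntegral_condExp h𝒢 hqi hS, ← hint _ _ (h𝒢 _ hS), hq, setIntegral_condExp h𝒢 hi1 hS,
      hint _ _ (h𝒢 _ hS)]
  have h2 : P[fun ω => ρ ω * q ω | 𝒢] =ᵐ[P] fun ω => (P[ρ | 𝒢]) ω * q ω :=
    condExp_mul_of_stronglyMeasurable_right hqm hqi hρi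
  have h0 : condWeight 𝒢 P ρ Set.univ = P[ρ | 𝒢] := by simp [condWeight]
  filter_upwards [h1, h2] with ω h1ω h2ω
  rw [h0, ← h1ω, h2ω, mul_comm]

/-- The determinant `E(ρ 1_A | 𝒢) E(ρ' | 𝒢) - E(ρ' 1_A | 𝒢) E(ρ | 𝒢)`, which vanishes
where `A` has the same conditional probability under `ρ · P` and `ρ' · P`. -/
noncomputable def condDet (𝒢 : MeasurableSpace Ω) {mΩ : MeasurableSpace Ω} (P : Measure Ω)
    (ρ ρ' : Ω → ℝ) (A : Set Ω) (ω : Ω) : ℝ :=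
  condWeight 𝒢 P ρ A ω * condWeight 𝒢 P ρ' Set.univ ω -
    condWeight 𝒢 P ρ' A ω * condWeight 𝒢 P ρ Set.univ ω

/-- Conditional independence of `A` and `B` given `𝒢` under all product densities. -/
def CondIndepWeights (𝒢 : MeasurableSpace Ω) {mΩ : MeasurableSpace Ω} (m : I → MeasurableSpace Ω)
    (P : Measure Ω) (A B : Set Ω) : Prop :=
  ∀ ρ, IsProductDensity m P ρ → ∀ᵐ ω ∂P,
    condWeight 𝒢 P ρ A ω * condWeight 𝒢 P ρ B ω =
      condWeight 𝒢 P ρ (A ∩ B) ω * condWeight 𝒢 P ρ Set.univ ω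

/-- Here `x k / w k` and `y k / w k` play the conditional probabilities of `A` and `B` under the
`k`-th density, and `h` is conditional independence under the midpoints. It says that each pair `k,
l` agrees in the first ratio or in the second. -/
theorem det_mul_det_eq_zero {x y z w : Fin 4 → ℝ} (hw : ∀ k, 0 < w k)
    (h : ∀ k l, (x k + x l) * (y k + y l) = (z k + z l) * (w k + w l)) :
    (x 0 * w 1 - x 1 * w 0) * (y 2 * w 3 - y 3 * w 2) = 0 := by
  -- The diagonal case `k = l` eliminates `z`; the off-diagonal cases become products of differences
  -- of ratios.
  have hz : ∀ k, z k = x k * y k / w k := fun k => by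
    rw [eq_div_iff (hw k).ne']
    linarith [h k k]
  have key : ∀ k l, (x k / w k - x l / w l) * (y k / w k - y l / w l) = 0 := by
    intro k l
    have h1 := h k l
    rw [hz k, hz l] at h1
    have hk := (hw k).ne'
    have hl := (hw l).ne'
    field_simp at h1 ⊢
    linear_combination (-1 : ℝ) * h1
  have key' : ∀ k l, x k / w k = x l / w l ∨ y k / w k = y l / w l := fun k l =>
    (mul_eq_zero.1 (key k l)).imp sub_eq_zero.1 sub_eq_zero.1
  have goal : x 0 / w 0 = x 1 / w 1 ∨ y 2 / w 2 = y 3 / w 3 := by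
    -- Were `0, 1` separated in the first ratio and `2, 3` in the second, then `0, 1` would agree in
    -- the second and `2, 3` in the first; the cross pairs and transitivity contradict this.
    have h01 := key' 0 1
    have h02 := key' 0 2
    have h03 := key' 0 3
    have h12 := key' 1 2
    have h13 := key' 1 3
    have h23 := key' 2 3
    grind
  rcases goal with h | h
  · rw [div_eq_div_iff (hw 0).ne' (hw 1).ne'] at h
    rw [h, sub_self, zero_mul]
  · rw [div_eq_div_iff (hw 2).ne' (hw 3).ne'] at h
    rw [h, sub_self, mul_zero]

theorem condDet_mul_condDet_eq_zero {𝒢 mΩ : MeasurableSpace Ω} (h𝒢 : 𝒢 ≤ mΩ)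
    {m : I → MeasurableSpace Ω} {P : Measure Ω} [IsProbabilityMeasure P] {A B : Set Ω}
    (hA : MeasurableSet A) (hB : MeasurableSet B) (H : CondIndepWeights 𝒢 m P A B)
    {ρ : Fin 4 → Ω → ℝ}
    (hρ : ∀ k l, IsProductDensity m P fun ω => (1 - 1 / 2) * ρ k ω + 1 / 2 * ρ l ω) :
    ∀ᵐ ω ∂P, condDet 𝒢 P (ρ 0) (ρ 1) A ω * condDet 𝒢 P (ρ 2) (ρ 3) B ω = 0 := by
  have hρ' : ∀ k, IsProductDensity m P (ρ k) := fun k => by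
    convert hρ k k using 2
    ring
  have hi : ∀ k, Integrable (ρ k) P := fun k => (hρ' k).integrable
  have lin : ∀ S, MeasurableSet S → ∀ᵐ ω ∂P, ∀ k l,
      condWeight 𝒢 P (fun ω => (1 - 1 / 2) * ρ k ω + 1 / 2 * ρ l ω) S ω =
        (1 / 2) * (condWeight 𝒢 P (ρ k) S ω + condWeight 𝒢 P (ρ l) S ω) := by
    intro S hS
    rw [ae_all_iff]
    intro k
    rw [ae_all_iff]
    intro l
    have h1 := condWeight_sum (𝒢 := 𝒢) (P := P) hS (Finset.univ : Finset (Fin 2))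
      (fun _ => 1 / 2) (u := ![ρ k, ρ l]) (fun i _ => by fin_cases i <;> simp [hi])
    have h2 : (fun ω => ∑ i : Fin 2, (1 / 2 : ℝ) * (![ρ k, ρ l] : Fin 2 → Ω → ℝ) i ω) =
        fun ω => (1 - 1 / 2) * ρ k ω + 1 / 2 * ρ l ω := by
      ext ω
      simp only [Fin.sum_univ_two, Matrix.cons_val_zero, Matrix.cons_val_one]
      ring
    rw [h2] at h1
    filter_upwards [h1] with ω hω
    rw [hω]
    simp [Fin.sum_univ_two]
    ring
  have hpos : ∀ᵐ ω ∂P, ∀ k, 0 < condWeight 𝒢 P (ρ k) Set.univ ω := by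
    rw [ae_all_iff]
    exact fun k => condWeight_univ_pos h𝒢 (hi k) (hρ' k).pos
  have hH : ∀ᵐ ω ∂P, ∀ k l, _ := ae_all_iff.2 fun k => ae_all_iff.2 fun l => H _ (hρ k l)
  filter_upwards [lin A hA, lin B hB, lin _ (hA.inter hB), lin _ MeasurableSet.univ, hpos, hH]
    with ω h1 h2 h3 h4 hw h
  refine det_mul_det_eq_zero (x := fun k => condWeight 𝒢 P (ρ k) A ω)
    (y := fun k => condWeight 𝒢 P (ρ k) B ω) (z := fun k => condWeight 𝒢 P (ρ k) (A ∩ B) ω)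
    (w := fun k => condWeight 𝒢 P (ρ k) Set.univ ω) hw fun k l => ?_
  have := h k l
  rw [h1, h2, h3, h4] at this
  linarith

/-- The path of densities from `a` at `s = 0` to `ψ · a · ∏ j ∈ K, f j` at `s = 1`. -/
noncomputable def pathDensity (ψ : Ω → ℝ) (f : I → Ω → ℝ) (K : Finset I) (a : Ω → ℝ) (s : ℝ) :
    Ω → ℝ :=
  fun ω => ((1 - s) + s * ψ ω) * (a ω * ∏ j ∈ K, ((1 - s) * 1 + s * f j ω))

/-- Since `i ∉ K`, the extra factor `a` is just the `i`-th factor of a product over `insert i K`. -/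
theorem isProductDensity_mul_mul_prod {mΩ : MeasurableSpace Ω} {m : I → MeasurableSpace Ω}
    (hm : ∀ j, m j ≤ mΩ) {P : Measure Ω} (h : iIndep m P) {ψ : Ω → ℝ}
    (hψ : IsNeutralDensity (⨆ j, m j) P ψ) {f : I → Ω → ℝ} (hf : ∀ j, IsDensity (m j) P (f j))
    {K : Finset I} {i : I} (hi : i ∉ K) {a : Ω → ℝ} (ha : IsDensity (m i) P a) :
    IsProductDensity m P fun ω => ψ ω * (a ω * ∏ j ∈ K, f j ω) := by
  classical
  have h1 := isProductDensity_mul_prod hm h hψ (f := Function.update f i a) (fun j => by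
    by_cases hj : j = i
    · subst hj
      simpa using ha
    · simpa [hj] using hf j) (insert i K)
  convert h1 using 3 with ω
  rw [Finset.prod_insert hi, Function.update_self]
  congr 1
  refine Finset.prod_congr rfl fun j hj => ?_
  rw [Function.update_of_ne (ne_of_mem_of_not_mem hj hi)]

theorem isProductDensity_pathDensity {mΩ : MeasurableSpace Ω} {m : I → MeasurableSpace Ω}
    (hm : ∀ j, m j ≤ mΩ) {P : Measure Ω} (h : iIndep m P) {ψ : Ω → ℝ}
    (hψ : IsNeutralDensity (⨆ j, m j) P ψ) {f : I → Ω → ℝ} (hf : ∀ j, IsDensity (m j) P (f j))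
    {K : Finset I} {i : I} (hi : i ∉ K) {a : Ω → ℝ} (ha : IsDensity (m i) P a) {s : ℝ}
    (hs0 : 0 < s) (hs1 : s < 1) :
    IsProductDensity m P (pathDensity ψ f K a s) := by
  have := h.isProbabilityMeasure
  exact isProductDensity_mul_mul_prod hm h (hψ.convex (iSup_le hm) hs0 hs1)
    (fun j => IsDensity.one.convex (hm j) (hf j) hs0 hs1) hi ha

/-- Along the path, conditional weights are polynomial in the parameter. -/
theorem exists_polynomial_condWeight_pathDensity {𝒢 mΩ : MeasurableSpace Ω}
    {m : I → MeasurableSpace Ω} (hm : ∀ j, m j ≤ mΩ) {P : Measure Ω} (h : iIndep m P) {ψ : Ω → ℝ}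
    (hψ : IsNeutralDensity (⨆ j, m j) P ψ) {f : I → Ω → ℝ} (hf : ∀ j, IsDensity (m j) P (f j))
    {K : Finset I} {i : I} (hi : i ∉ K) {a : Ω → ℝ} (ha : IsDensity (m i) P a)
    {A : Set Ω} (hA : MeasurableSet A) :
    ∃ p : Ω → ℝ[X], ∀ s : ℝ,
      ∀ᵐ ω ∂P, condWeight 𝒢 P (pathDensity ψ f K a s) A ω = (p ω).eval s := by
  classical
  -- Expanding the path gives one term for each subset `T` of `K` (where `f j` is chosen) and each
  -- choice in the neutral factor: `u` goes with `1 - s`, `v` with `s * ψ`. Their conditional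
  -- weights are the `s`-free coefficients.
  let u : Finset I → Ω → ℝ := fun T ω => a ω * ∏ j ∈ T, f j ω
  let v : Finset I → Ω → ℝ := fun T ω => ψ ω * (a ω * ∏ j ∈ T, f j ω)
  have hv : ∀ T ∈ K.powerset, Integrable (v T) P := fun T hT =>
    (isProductDensity_mul_mul_prod hm h hψ hf
      (fun hiT => hi (Finset.mem_powerset.1 hT hiT)) ha).integrable
  have hu : ∀ T ∈ K.powerset, Integrable (u T) P := fun T hT => by
    simpa using (isProductDensity_mul_mul_prod hm h IsNeutralDensity.one hf
      (fun hiT => hi (Finset.mem_powerset.1 hT hiT)) ha).integrable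
  let c : ℝ → Finset I → ℝ := fun s T => s ^ T.card * (1 - s) ^ (K \ T).card
  refine ⟨fun ω => ∑ k ∈ K.powerset ×ˢ (Finset.univ : Finset Bool),
    (Polynomial.X ^ k.1.card * (1 - Polynomial.X) ^ (K \ k.1).card) *
      (if k.2 then (1 - Polynomial.X) * Polynomial.C (condWeight 𝒢 P (u k.1) A ω)
        else Polynomial.X * Polynomial.C (condWeight 𝒢 P (v k.1) A ω)), fun s => ?_⟩
  have h1 := condWeight_sum (𝒢 := 𝒢) (P := P) hA
    (K.powerset ×ˢ (Finset.univ : Finset Bool)) (fun k => c s k.1 * if k.2 then 1 - s else s)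
    (u := fun k => if k.2 then u k.1 else v k.1) (fun k hk => by
      have hk1 := (Finset.mem_product.1 hk).1
      rcases k with ⟨T, b⟩
      cases b
      · simpa using hv T hk1
      · simpa using hu T hk1)
  have h2 : (fun ω => ∑ k ∈ K.powerset ×ˢ (Finset.univ : Finset Bool),
      (c s k.1 * if k.2 then 1 - s else s) *
        (if k.2 then u k.1 else v k.1) ω) = pathDensity ψ f K a s := by
    ext ω
    have h3 : ∏ j ∈ K, ((1 - s) * 1 + s * f j ω) =
        ∑ T ∈ K.powerset, c s T * ∏ j ∈ T, f j ω := by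
      simp_rw [add_comm ((1 - s) * 1), Finset.prod_add, Finset.prod_mul_distrib,
        Finset.prod_const, one_pow, mul_one]
      exact Finset.sum_congr rfl fun T _ => by simp only [c]; ring
    rw [Finset.sum_product, pathDensity, h3, Finset.mul_sum, Finset.mul_sum]
    refine Finset.sum_congr rfl fun T _ => ?_
    simp [u, v]
    ring
  rw [h2] at h1
  filter_upwards [h1] with ω hω
  rw [hω, Polynomial.eval_finsetSum]
  refine Finset.sum_congr rfl fun k _ => ?_
  rcases k with ⟨T, b⟩
  cases b <;> simp [c] <;> ring

/-- Infinitely many roots make `p * q` zero, hence `p` or `q`. This transfers the vanishing from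
parameters inside `(0, 1)` to two different endpoints. -/
theorem eval_zero_or_eval_one_eq_zero {p q : ℝ[X]}
    (h : ∀ n : ℕ, p.eval (1 / ((n : ℝ) + 2)) * q.eval (1 / ((n : ℝ) + 2)) = 0) :
    p.eval 0 * q.eval 1 = 0 := by
  have hpq : p * q = 0 := by
    refine Polynomial.eq_zero_of_infinite_isRoot _ ?_
    refine Set.infinite_of_injective_forall_mem (f := fun n : ℕ => 1 / ((n : ℝ) + 2)) ?_ ?_
    · intro a b hab
      simpa using hab
    · intro n
      simpa [Polynomial.IsRoot] using h n
  rcases mul_eq_zero.1 hpq with h | h <;> simp [h]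

/-- Only countably many parameters `1 / (n + 2)` are used, so the almost sure statements hold
simultaneously, and for almost every `ω` the argument is about two real polynomials. -/
theorem condDet_path_eq_zero {𝒢 mΩ : MeasurableSpace Ω} (h𝒢 : 𝒢 ≤ mΩ)
    {m : I → MeasurableSpace Ω} (hm : ∀ j, m j ≤ mΩ) {P : Measure Ω} (h : iIndep m P) {ψ : Ω → ℝ}
    (hψ : IsNeutralDensity (⨆ j, m j) P ψ) {f : I → Ω → ℝ} (hf : ∀ j, IsDensity (m j) P (f j))
    {K : Finset I} {i : I} (hi : i ∉ K) {a : Fin 4 → Ω → ℝ} (ha : ∀ k, IsDensity (m i) P (a k))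
    {A B : Set Ω} (hA : MeasurableSet A) (hB : MeasurableSet B)
    (H : CondIndepWeights 𝒢 m P A B) :
    ∀ᵐ ω ∂P, condDet 𝒢 P (a 0) (a 1) A ω *
      condDet 𝒢 P (fun ω => ψ ω * (a 2 ω * ∏ j ∈ K, f j ω))
        (fun ω => ψ ω * (a 3 ω * ∏ j ∈ K, f j ω)) B ω = 0 := by
  have := h.isProbabilityMeasure
  have hpoly := fun k (S : Set Ω) (hS : MeasurableSet S) =>
    exists_polynomial_condWeight_pathDensity (𝒢 := 𝒢) hm h hψ hf hi (ha k) hS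
  choose p hp using hpoly
  have hinner : ∀ᵐ ω ∂P, ∀ n : ℕ,
      condDet 𝒢 P (pathDensity ψ f K (a 0) (1 / ((n : ℝ) + 2)))
        (pathDensity ψ f K (a 1) (1 / ((n : ℝ) + 2))) A ω *
      condDet 𝒢 P (pathDensity ψ f K (a 2) (1 / ((n : ℝ) + 2)))
        (pathDensity ψ f K (a 3) (1 / ((n : ℝ) + 2))) B ω = 0 := by
    rw [ae_all_iff]
    intro n
    refine condDet_mul_condDet_eq_zero h𝒢 hA hB H
      (ρ := fun k => pathDensity ψ f K (a k) (1 / ((n : ℝ) + 2))) fun k l => ?_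
    have hs0 : (0 : ℝ) < 1 / ((n : ℝ) + 2) := by positivity
    have hs1 : 1 / ((n : ℝ) + 2) < 1 := by
      rw [div_lt_one (by positivity)]
      linarith [(Nat.cast_nonneg n : (0 : ℝ) ≤ n)]
    -- The path depends linearly on `a`, so a midpoint of two paths is the path of the midpoint,
    -- which is still a density for `m i`.
    convert isProductDensity_pathDensity hm h hψ hf hi
      ((ha k).convex (hm i) (ha l) (s := 1 / 2) (by norm_num) (by norm_num)) hs0 hs1 using 2 with ω
    simp only [pathDensity]
    ring
  have hev : ∀ (k : Fin 4) (S : Set Ω) (hS : MeasurableSet S), ∀ᵐ ω ∂P,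
      (∀ n : ℕ, condWeight 𝒢 P (pathDensity ψ f K (a k) (1 / ((n : ℝ) + 2))) S ω =
        (p k S hS ω).eval (1 / ((n : ℝ) + 2))) ∧
      condWeight 𝒢 P (a k) S ω = (p k S hS ω).eval 0 ∧
      condWeight 𝒢 P (fun ω => ψ ω * (a k ω * ∏ j ∈ K, f j ω)) S ω = (p k S hS ω).eval 1 := by
    intro k S hS
    have h0 : pathDensity ψ f K (a k) 0 = a k := by
      ext ω
      simp [pathDensity]
    have h1 : pathDensity ψ f K (a k) 1 = fun ω => ψ ω * (a k ω * ∏ j ∈ K, f j ω) := by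
      ext ω
      simp [pathDensity]
    have e0 := hp k S hS 0
    have e1 := hp k S hS 1
    rw [h0] at e0
    rw [h1] at e1
    filter_upwards [e0, e1, ae_all_iff.2 fun n : ℕ => hp k S hS (1 / ((n : ℝ) + 2))]
      with ω w0 w1 w2 using ⟨w2, w0, w1⟩
  filter_upwards [hinner, hev 0 A hA, hev 1 A hA, hev 2 B hB, hev 3 B hB,
    hev 0 _ MeasurableSet.univ, hev 1 _ MeasurableSet.univ, hev 2 _ MeasurableSet.univ,
    hev 3 _ MeasurableSet.univ] with ω h0 a0 a1 b2 b3 u0 u1 u2 u3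
  have hfin := eval_zero_or_eval_one_eq_zero
    (p := p 0 A hA ω * p 1 _ MeasurableSet.univ ω - p 1 A hA ω * p 0 _ MeasurableSet.univ ω)
    (q := p 2 B hB ω * p 3 _ MeasurableSet.univ ω - p 3 B hB ω * p 2 _ MeasurableSet.univ ω)
    (fun n => by
      simp only [Polynomial.eval_sub, Polynomial.eval_mul]
      rw [← a0.1 n, ← a1.1 n, ← b2.1 n, ← b3.1 n, ← u0.1 n, ← u1.1 n, ← u2.1 n, ← u3.1 n]
      exact h0 n)
  simp only [Polynomial.eval_sub, Polynomial.eval_mul] at hfin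
  simp only [condDet]
  rw [a0.2.1, a1.2.1, u0.2.1, u1.2.1, b2.2.2, b3.2.2, u2.2.2, u3.2.2]
  exact hfin

end ConditionalExpectations

/-! ### Approximation of general product densities by finite products -/

section Convergence

variable {Ω I : Type*}

open scoped ENNReal Topology symmDiff
open Filter

theorem biSup_finset_mono (m : I → MeasurableSpace Ω) {K L : Finset I} (h : K ⊆ L) :
    ⨆ j ∈ K, m j ≤ ⨆ j ∈ L, m j :=
  biSup_mono fun _ hj => h hj

theorem generateFrom_finset_biSup (m : I → MeasurableSpace Ω) :
    MeasurableSpace.generateFrom {t | ∃ K : Finset I, MeasurableSet[⨆ j ∈ K, m j] t} =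
      ⨆ j, m j := by
  apply le_antisymm
  · refine MeasurableSpace.generateFrom_le ?_
    rintro t ⟨K, ht⟩
    exact (iSup₂_le fun j _ => le_iSup m j : ⨆ j ∈ K, m j ≤ ⨆ j, m j) t ht
  · refine iSup_le fun j t ht => MeasurableSpace.measurableSet_generateFrom ⟨{j}, ?_⟩
    exact le_iSup₂ (f := fun k (_ : k ∈ ({j} : Finset I)) => m k) j
      (Finset.mem_singleton_self j) t ht

theorem isSetRing_finset_biSup (m : I → MeasurableSpace Ω) :
    IsSetRing {t | ∃ K : Finset I, MeasurableSet[⨆ j ∈ K, m j] t} := by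
  classical
  refine ⟨⟨∅, @MeasurableSet.empty _ (_)⟩, ?_, ?_⟩
  · rintro s t ⟨K, hs⟩ ⟨L, ht⟩
    exact ⟨K ∪ L, MeasurableSet.union (biSup_finset_mono m Finset.subset_union_left s hs)
      (biSup_finset_mono m Finset.subset_union_right t ht)⟩
  · rintro s t ⟨K, hs⟩ ⟨L, ht⟩
    exact ⟨K ∪ L, MeasurableSet.diff (biSup_finset_mono m Finset.subset_union_left s hs)
      (biSup_finset_mono m Finset.subset_union_right t ht)⟩

/-- Integrable functions measurable for `⨆ j, m j` are approximated in mean by functions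
depending on finitely many of the `m j`. -/
theorem exists_finset_approx {mU : MeasurableSpace Ω} {m : I → MeasurableSpace Ω}
    (hmU : mU = ⨆ j, m j) (P : Measure Ω) [IsFiniteMeasure P] {φ : Ω → ℝ} (hφ : MemLp φ 1 P)
    {ε : ℝ≥0∞} (hε : ε ≠ 0) :
    ∃ g : Ω → ℝ, eLpNorm (φ - g) 1 P ≤ ε ∧
      ∃ K : Finset I, StronglyMeasurable[⨆ j ∈ K, m j] g := by
  classical
  have hle : ∀ K : Finset I, ⨆ j ∈ K, m j ≤ mU := fun K => hmU ▸ iSup₂_le fun j _ => le_iSup m j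
  refine MemLp.induction_dense (by simp)
    (fun g => ∃ K : Finset I, StronglyMeasurable[⨆ j ∈ K, m j] g) ?_ ?_ ?_ hφ hε
  · intro c s hs _ δ hδ
    obtain ⟨η, hη, h⟩ := exists_eLpNorm_indicator_le (μ := P) (p := 1) (by simp) c hδ
    obtain ⟨t, ⟨K, ht⟩, hts⟩ := exists_measure_symmDiff_lt_of_generateFrom_isSetRing (μ := P)
      (isSetRing_finset_biSup m)
      ⟨{Set.univ}, Set.countable_singleton _, by
        rw [Set.singleton_subset_iff]
        exact ⟨∅, @MeasurableSet.univ _ (_)⟩, by simp⟩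
      (hmU.trans (generateFrom_finset_biSup m).symm) hs
      (ENNReal.coe_pos.2 hη)
    refine ⟨t.indicator fun _ => c, ?_, K, stronglyMeasurable_const.indicator ht⟩
    refine le_trans (eLpNorm_mono fun ω => ?_) (h _ hts.le)
    by_cases h1 : ω ∈ t <;> by_cases h2 : ω ∈ s <;> simp [h1, h2, Set.mem_symmDiff]
  · rintro f g ⟨K, hf⟩ ⟨L, hg⟩
    exact ⟨K ∪ L, (hf.mono (biSup_finset_mono m Finset.subset_union_left)).add
      (hg.mono (biSup_finset_mono m Finset.subset_union_right))⟩
  · rintro f ⟨K, hf⟩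
    exact (hf.mono (hle K)).aestronglyMeasurable

/-- Mean martingale convergence along the net of finite subsets, as `I` may be uncountable. A
function `g` of finitely many coordinates is fixed by all later conditional expectations, and these
contract the mean distance. -/
theorem tendsto_eLpNorm_condExp_finset {mΩ : MeasurableSpace Ω} {m : I → MeasurableSpace Ω}
    (hm : ∀ j, m j ≤ mΩ) {P : Measure Ω} [IsProbabilityMeasure P] (φ : Ω → ℝ) :
    Tendsto (fun K : Finset I => eLpNorm (P[φ | ⨆ j ∈ K, m j] - P[φ | ⨆ j, m j]) 1 P)
      atTop (𝓝 0) := by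
  have hU : ⨆ j, m j ≤ mΩ := iSup_le hm
  have hleU : ∀ K : Finset I, ⨆ j ∈ K, m j ≤ ⨆ j, m j := fun K =>
    iSup₂_le fun j _ => le_iSup m j
  classical
  refine ENNReal.tendsto_atTop_zero.2 fun ε hε => ?_
  -- The bound `1` keeps the distance finite even for `ε = ∞`, so that `g` is integrable.
  obtain ⟨g, hg, K, hgK⟩ := exists_finset_approx (m := m) rfl (P.trim hU) (φ := P[φ | ⨆ j, m j])
    (by
      rw [memLp_one_iff_integrable]
      exact integrable_condExp.trim hU stronglyMeasurable_condExp) (ε := min (ε / 2) 1)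
    (lt_min (ENNReal.half_pos hε.ne') one_pos).ne'
  rw [eLpNorm_trim hU (stronglyMeasurable_condExp.sub (hgK.mono (hleU K)))] at hg
  have hgm : AEStronglyMeasurable g P := (hgK.mono ((hleU K).trans hU)).aestronglyMeasurable
  have hgi : Integrable g P := by
    have h1 : MemLp (P[φ | ⨆ j, m j] - g) 1 P :=
      ⟨integrable_condExp.aestronglyMeasurable.sub hgm,
        hg.trans_lt ((min_le_right _ _).trans_lt ENNReal.one_lt_top)⟩
    have h2 := (integrable_condExp (μ := P) (f := φ) (m := ⨆ j, m j)).sub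
      (memLp_one_iff_integrable.1 h1)
    simpa using h2
  replace hg := hg.trans (min_le_left _ _)
  refine ⟨K, fun L hL => ?_⟩
  have hLU : ⨆ j ∈ L, m j ≤ mΩ := (hleU L).trans hU
  have h1 : P[φ | ⨆ j ∈ L, m j] - P[φ | ⨆ j, m j] =ᵐ[P]
      P[P[φ | ⨆ j, m j] - g | ⨆ j ∈ L, m j] - (P[φ | ⨆ j, m j] - g) := by
    have h2 : P[g | ⨆ j ∈ L, m j] = g :=
      condExp_of_stronglyMeasurable hLU (hgK.mono (biSup_finset_mono m hL)) hgi
    have h3 := condExp_sub (m := ⨆ j ∈ L, m j) (μ := P)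
      (integrable_condExp (f := φ) (m := ⨆ j, m j)) hgi
    have h4 := condExp_condExp_of_le (μ := P) (f := φ) (hleU L) hU
    rw [h2] at h3
    filter_upwards [h3, h4] with ω w3 w4
    simp only [Pi.sub_apply] at w3 ⊢
    rw [w3, w4]
    ring
  rw [eLpNorm_congr_ae h1]
  calc _ ≤ eLpNorm (P[P[φ | ⨆ j, m j] - g | ⨆ j ∈ L, m j]) 1 P +
        eLpNorm (P[φ | ⨆ j, m j] - g) 1 P :=
        eLpNorm_sub_le integrable_condExp.aestronglyMeasurable
          (integrable_condExp.aestronglyMeasurable.sub hgm) le_rfl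
    _ ≤ ε / 2 + ε / 2 := add_le_add ((eLpNorm_condExp_le_eLpNorm _ le_rfl).trans hg) hg
    _ = ε := ENNReal.add_halves ε

theorem tilt_apply {mΩ : MeasurableSpace Ω} {P : Measure Ω} {ρ : Ω → ℝ} (hρ : Integrable ρ P)
    (hpos : ∀ ω, 0 < ρ ω) {A : Set Ω} (hA : MeasurableSet A) :
    tilt P ρ A = ENNReal.ofReal (∫ ω in A, ρ ω ∂P) := by
  rw [tilt, withDensity_apply _ hA, ofReal_integral_eq_lintegral_ofReal hρ.integrableOn
    (Eventually.of_forall fun ω => (hpos ω).le)]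

theorem condExp_ae_eq_of_tilt_eq {n mΩ : MeasurableSpace Ω} (hn : n ≤ mΩ) {P : Measure Ω}
    [IsProbabilityMeasure P] {g φ : Ω → ℝ} (hg : IsDensity n P g) (hφ : IsDensity mΩ P φ)
    (h : ∀ A, MeasurableSet[n] A → tilt P g A = tilt P φ A) : g =ᵐ[P] P[φ | n] := by
  have hgi := hg.integrable hn
  have hφi := hφ.integrable le_rfl
  refine ae_eq_condExp_of_forall_setIntegral_eq hn hφi (fun A _ _ => hgi.integrableOn)
    (fun A hA _ => ?_) hg.measurable.stronglyMeasurable.aestronglyMeasurable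
  have h1 := h A hA
  rw [tilt_apply hgi hg.pos (hn _ hA), tilt_apply hφi hφ.pos (hn _ hA)] at h1
  exact (ENNReal.ofReal_eq_ofReal_iff (integral_nonneg fun ω => (hg.pos ω).le)
    (integral_nonneg fun ω => (hφ.pos ω).le)).1 h1

/-- The density of `φ · P` with respect to `P` on the sigma-algebra `n`. -/
theorem exists_condDensity {n mΩ : MeasurableSpace Ω} (hn : n ≤ mΩ) {P : Measure Ω}
    [IsProbabilityMeasure P] {φ : Ω → ℝ} (hφ : IsDensity mΩ P φ) :
    ∃ g, IsDensity n P g ∧ ∀ A, MeasurableSet[n] A → tilt P g A = tilt P φ A := by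
  classical
  have hφi := hφ.integrable le_rfl
  let c := P[φ | n]
  have hc : Measurable[n] c := stronglyMeasurable_condExp.measurable
  have hS : MeasurableSet[n] {ω | 0 < c ω} := measurableSet_lt measurable_const hc
  -- The default `1` is taken only on a null set; it makes the density positive everywhere.
  let g : Ω → ℝ := fun ω => if 0 < c ω then c ω else 1
  have hgm : Measurable[n] g := Measurable.ite hS hc measurable_const
  have hpos : ∀ ω, 0 < g ω := fun ω => by
    simp only [g]
    split_ifs with h
    exacts [h, one_pos]
  have hgc : g =ᵐ[P] c := by
    filter_upwards [condExp_pos_of_pos hn hφi hφ.pos] with ω hω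
    exact if_pos hω
  have hgi : Integrable g P := (integrable_congr hgc).2 integrable_condExp
  have htilt : ∀ A, MeasurableSet[n] A → tilt P g A = tilt P φ A := fun A hA => by
    rw [tilt_apply hgi hpos (hn _ hA), tilt_apply hφi hφ.pos (hn _ hA),
      integral_congr_ae (ae_restrict_of_ae hgc), setIntegral_condExp hn hφi hA]
  refine ⟨g, ⟨hgm, hpos, ?_⟩, htilt⟩
  have h1 := htilt Set.univ MeasurableSet.univ
  rw [tilt, tilt, withDensity_apply _ MeasurableSet.univ, withDensity_apply _ MeasurableSet.univ,
    setLIntegral_univ, setLIntegral_univ] at h1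
  rw [h1, hφ.lintegral_eq]

theorem lintegral_mul_eq_of_tilt_eq {n mΩ : MeasurableSpace Ω} (hn : n ≤ mΩ) {P : Measure Ω}
    {g φ : Ω → ℝ} (hg : Measurable g) (hφ : Measurable φ)
    (h : ∀ A, MeasurableSet[n] A → tilt P g A = tilt P φ A) {u : Ω → ℝ≥0∞}
    (hu : Measurable[n] u) :
    ∫⁻ ω, ENNReal.ofReal (g ω) * u ω ∂P = ∫⁻ ω, ENNReal.ofReal (φ ω) * u ω ∂P := by
  have h1 : (tilt P g).trim hn = (tilt P φ).trim hn := by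
    refine @Measure.ext _ n _ _ fun A hA => ?_
    rw [trim_measurableSet_eq hn hA, trim_measurableSet_eq hn hA, h A hA]
  have h2 := lintegral_trim (μ := tilt P g) hn hu
  rw [h1, lintegral_trim hn hu, lintegral_withDensity_eq_lintegral_mul _ (by fun_prop)
    (hu.mono hn le_rfl), lintegral_withDensity_eq_lintegral_mul _ (by fun_prop)
    (hu.mono hn le_rfl)] at h2
  exact h2.symm

/-- Dividing by the restricted density `g` leaves no change on `n`: test the equality of `tilt P g`
and `tilt P φ` on `n` with `1_A / g`. -/
theorem isNeutralDensity_div {n mΩ : MeasurableSpace Ω} (hn : n ≤ mΩ) {P : Measure Ω}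
    {g φ : Ω → ℝ} (hg : IsDensity n P g) (hφ : IsDensity mΩ P φ)
    (h : ∀ A, MeasurableSet[n] A → tilt P g A = tilt P φ A) :
    IsNeutralDensity n P fun ω => φ ω / g ω where
  measurable := hφ.measurable.div (hg.measurable.mono hn le_rfl)
  pos ω := div_pos (hφ.pos ω) (hg.pos ω)
  tilt_eq A hA := by
    have hu : Measurable[n] (A.indicator fun ω => ENNReal.ofReal (g ω)⁻¹) :=
      (ENNReal.measurable_ofReal.comp hg.measurable.inv).indicator hA
    have h1 := lintegral_mul_eq_of_tilt_eq hn (hg.measurable.mono hn le_rfl) hφ.measurable h hu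
    have h2 : ∀ ρ : Ω → ℝ, (fun ω => ENNReal.ofReal (ρ ω) *
        A.indicator (fun ω => ENNReal.ofReal (g ω)⁻¹) ω) =
        A.indicator fun ω => ENNReal.ofReal (ρ ω) * ENNReal.ofReal (g ω)⁻¹ := fun ρ => by
      ext ω
      by_cases hω : ω ∈ A <;> simp [hω]
    rw [h2, h2, lintegral_indicator (hn _ hA), lintegral_indicator (hn _ hA)] at h1
    simp only [← ENNReal.ofReal_mul (hg.pos _).le, ← ENNReal.ofReal_mul (hφ.pos _).le,
      mul_inv_cancel₀ (hg.pos _).ne'] at h1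
    rw [tilt, withDensity_apply _ (hn _ hA)]
    simpa [div_eq_mul_inv] using h1.symm

/-- Under independence, the conditional density on finitely many coordinates is a product. -/
theorem prod_ae_eq_condExp {mΩ : MeasurableSpace Ω} {m : I → MeasurableSpace Ω}
    (hm : ∀ j, m j ≤ mΩ) {P : Measure Ω} (h : iIndep m P) {φ : Ω → ℝ}
    (hφ : IsProductDensity m P φ) {f : I → Ω → ℝ} (hf : ∀ j, IsDensity (m j) P (f j))
    (hfφ : ∀ j A, MeasurableSet[m j] A → tilt P (f j) A = tilt P φ A) (K : Finset I) :
    (fun ω => ∏ j ∈ K, f j ω) =ᵐ[P] P[φ | ⨆ j ∈ K, m j] := by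
  have := h.isProbabilityMeasure
  have hle : ⨆ j ∈ K, m j ≤ mΩ := iSup₂_le fun j _ => hm j
  have hprod : IsProductDensity m P fun ω => ∏ j ∈ K, f j ω := by
    simpa using isProductDensity_mul_prod hm h IsNeutralDensity.one hf K
  refine condExp_ae_eq_of_tilt_eq hle
    ⟨Finset.measurable_fun_prod _ fun j hj =>
      (hf j).measurable.mono (le_iSup₂ (f := fun j (_ : j ∈ K) => m j) j hj) le_rfl, hprod.pos,
      hprod.isDensity.lintegral_eq⟩ hφ.isDensity fun A hA => ?_
  -- Both tilted measures make the coordinates independent, so comparing their marginals is enough.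
  refine eq_on_biSup_of_iIndep hm hprod.indep hφ.indep (K := K) (fun j hj B hB => ?_) hA
  rw [← hfφ j B hB, tilt, tilt, withDensity_apply (fun ω => ENNReal.ofReal (f j ω)) (hm j _ hB)]
  simp only [ENNReal.ofReal_prod_of_nonneg fun j _ => ((hf j).pos _).le]
  exact (iIndep_withDensity_prod hm h (f := fun j ω => ENNReal.ofReal (f j ω))
    (fun j => ENNReal.measurable_ofReal.comp (hf j).measurable) (fun j => (hf j).lintegral_eq)
    K).2 j hj B hB

/-- The neutral part of `φ` times finite products of its marginal densities converges to `φ` in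
mean, also after multiplication with a function of a single coordinate. -/
theorem tendsto_eLpNorm_neutral_mul_prod {mΩ : MeasurableSpace Ω} {m : I → MeasurableSpace Ω}
    (hm : ∀ j, m j ≤ mΩ) {P : Measure Ω} (h : iIndep m P) {φ : Ω → ℝ}
    (hφ : IsProductDensity m P φ) {f : I → Ω → ℝ} (hf : ∀ j, IsDensity (m j) P (f j))
    (hfφ : ∀ j A, MeasurableSet[m j] A → tilt P (f j) A = tilt P φ A) {g : Ω → ℝ}
    (hg : IsDensity (⨆ j, m j) P g)
    (hgφ : ∀ A, MeasurableSet[⨆ j, m j] A → tilt P g A = tilt P φ A) {i : I} {b : Ω → ℝ}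
    (hb : Measurable[m i] b) (hbφ : Integrable (fun ω => b ω * φ ω) P) :
    Tendsto (fun K : Finset I => eLpNorm
      ((fun ω => φ ω / g ω * (b ω * ∏ j ∈ K, f j ω)) - fun ω => b ω * φ ω) 1 P) atTop (𝓝 0) := by
  have := h.isProbabilityMeasure
  have hU : ⨆ j, m j ≤ mΩ := iSup_le hm
  have hψ := isNeutralDensity_div hU hg hφ.isDensity hgφ
  have hgU : g =ᵐ[P] P[φ | ⨆ j, m j] :=
    condExp_ae_eq_of_tilt_eq hU hg hφ.isDensity hgφ
  have hbm : ∀ n, m i ≤ n → StronglyMeasurable[n] b := fun n hn =>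
    (hb.mono hn le_rfl).stronglyMeasurable
  refine (tendsto_eLpNorm_condExp_finset hm (P := P) (fun ω => b ω * φ ω)).congr' ?_
  filter_upwards [eventually_ge_atTop {i}] with K hK
  have hiK : m i ≤ ⨆ j ∈ K, m j :=
    le_iSup₂ (f := fun j (_ : j ∈ K) => m j) i (Finset.singleton_subset_iff.1 hK)
  have h1 : P[fun ω => b ω * φ ω | ⨆ j ∈ K, m j] - P[fun ω => b ω * φ ω | ⨆ j, m j] =ᵐ[P]
      fun ω => b ω * ∏ j ∈ K, f j ω - b ω * g ω := by
    filter_upwards [condExp_mul_of_stronglyMeasurable_left (hbm _ hiK) hbφ hφ.integrable,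
      condExp_mul_of_stronglyMeasurable_left (hbm _ (le_iSup m i)) hbφ hφ.integrable,
      prod_ae_eq_condExp hm h hφ hf hfφ K, hgU] with ω w1 w2 w3 w4
    simp only [Pi.sub_apply]
    rw [w3, w4]
    exact congrArg₂ (· - ·) w1 w2
  have h2 : Measurable[⨆ j, m j] fun ω => b ω * ∏ j ∈ K, f j ω - b ω * g ω := by
    have hbU : Measurable[⨆ j, m j] b := hb.mono (le_iSup m i) le_rfl
    exact (hbU.mul (Finset.measurable_fun_prod _ fun j _ =>
      (hf j).measurable.mono (le_iSup m j) le_rfl)).sub (hbU.mul hg.measurable)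
  rw [eLpNorm_congr_ae h1, eLpNorm_one_eq_lintegral_enorm, eLpNorm_one_eq_lintegral_enorm]
  -- The integrand is measurable for `⨆ j, m j`, so inserting the neutral factor `φ / g` does not
  -- change the mean norm, while it turns `b * g` into `b * φ`.
  refine (hψ.lintegral_mul hU (measurable_enorm.comp h2)).symm.trans
    (lintegral_congr fun ω => ?_)
  rw [Function.comp_apply, ← Real.enorm_of_nonneg (hψ.pos ω).le, ← enorm_mul]
  congr 1
  have := (hg.pos ω).ne'
  simp only [Pi.sub_apply]
  field_simp

/-- The filter need not be countably generated, so a sequence with errors below `1 / (n + 1)` is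
picked first. Passing to an almost surely convergent subsequence for the sum of the errors serves
all `k` at once. -/
theorem exists_seq_tendsto_ae_of_tendsto_eLpNorm {ι κ : Type*} [Fintype κ] {l : Filter ι} [NeBot l]
    {mΩ : MeasurableSpace Ω} {P : Measure Ω} {u : κ → ι → Ω → ℝ} {v : κ → Ω → ℝ}
    (hu : ∀ k n, AEStronglyMeasurable (u k n) P) (hv : ∀ k, AEStronglyMeasurable (v k) P)
    (h : ∀ k, Tendsto (fun n => eLpNorm (u k n - v k) 1 P) l (𝓝 0)) {p : ι → Prop}
    (hp : ∀ᶠ n in l, p n) :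
    ∃ ns : ℕ → ι, (∀ n, p (ns n)) ∧
      ∀ᵐ ω ∂P, ∀ k, Tendsto (fun n => u k (ns n) ω) atTop (𝓝 (v k ω)) := by
  have h1 : ∀ n : ℕ, ∃ i, p i ∧ ∀ k, eLpNorm (u k i - v k) 1 P < 1 / ((n : ℝ≥0∞) + 1) := by
    intro n
    have h2 : ∀ᶠ i in l, ∀ k, eLpNorm (u k i - v k) 1 P < 1 / ((n : ℝ≥0∞) + 1) := by
      rw [eventually_all]
      exact fun k => (h k).eventually_lt_const (by simp)
    exact (hp.and h2).exists
  choose ns hns hlt using h1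
  have h3 : ∀ k, Tendsto (fun n => eLpNorm (u k (ns n) - v k) 1 P) atTop (𝓝 0) := by
    intro k
    refine tendsto_of_tendsto_of_tendsto_of_le_of_le tendsto_const_nhds ?_ (fun _ => zero_le)
      (fun n => (hlt n k).le)
    have := ENNReal.tendsto_inv_nat_nhds_zero.comp (tendsto_add_atTop_nat 1)
    refine this.congr fun n => by simp
  let d : ℕ → Ω → ℝ := fun n => ∑ k, fun ω => ‖(u k (ns n) - v k) ω‖
  have hdm : ∀ k n, AEStronglyMeasurable (fun ω => ‖(u k (ns n) - v k) ω‖) P := fun k n =>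
    ((hu k (ns n)).sub (hv k)).norm
  have h4 : Tendsto (fun n => eLpNorm (d n - 0) 1 P) atTop (𝓝 0) := by
    have h5 : Tendsto (fun n => ∑ k, eLpNorm (u k (ns n) - v k) 1 P) atTop (𝓝 0) := by
      simpa using tendsto_finsetSum Finset.univ fun k _ => h3 k
    refine tendsto_of_tendsto_of_tendsto_of_le_of_le tendsto_const_nhds h5 (fun _ => zero_le)
      fun n => ?_
    rw [sub_zero]
    refine (eLpNorm_sum_le (fun k _ => hdm k n) le_rfl).trans_eq ?_
    exact Finset.sum_congr rfl fun k _ => eLpNorm_norm _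
  obtain ⟨ms, hms, hae⟩ := (tendstoInMeasure_of_tendsto_eLpNorm one_ne_zero
    (fun n => Finset.aestronglyMeasurable_sum _ fun k _ => hdm k n)
    aestronglyMeasurable_const h4).exists_seq_tendsto_ae
  refine ⟨ns ∘ ms, fun n => hns _, ?_⟩
  filter_upwards [hae] with ω hω k
  rw [tendsto_iff_norm_sub_tendsto_zero]
  refine tendsto_of_tendsto_of_tendsto_of_le_of_le tendsto_const_nhds hω
    (fun _ => norm_nonneg _) fun n => ?_
  simp only [Finset.sum_apply]
  exact Finset.single_le_sum (f := fun k => ‖(u k (ns (ms n)) - v k) ω‖)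
    (fun k _ => norm_nonneg _) (Finset.mem_univ k)

theorem eLpNorm_condWeight_sub_le {𝒢 mΩ : MeasurableSpace Ω} {P : Measure Ω} {ρ ρ' : Ω → ℝ}
    (hρ : Integrable ρ P) (hρ' : Integrable ρ' P) {A : Set Ω} (hA : MeasurableSet A) :
    eLpNorm (condWeight 𝒢 P ρ A - condWeight 𝒢 P ρ' A) 1 P ≤ eLpNorm (ρ - ρ') 1 P := by
  have h1 := condExp_sub (integrable_mul_indicator_one hρ hA)
    (integrable_mul_indicator_one hρ' hA) 𝒢
  rw [condWeight, condWeight, ← eLpNorm_congr_ae h1]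
  refine (eLpNorm_condExp_le_eLpNorm _ le_rfl).trans (eLpNorm_mono fun ω => ?_)
  by_cases hω : ω ∈ A <;> simp [hω]

/-- For finite `K` containing `i`, the `i`-th marginal density is split off the product and used as
the factor `a` of the path, with or without `c`. Then `K` grows along a sequence on which the four
conditional weights in the second determinant converge almost surely. -/
theorem condDet_mul_condDet_productDensity_eq_zero {𝒢 mΩ : MeasurableSpace Ω} (h𝒢 : 𝒢 ≤ mΩ)
    {m : I → MeasurableSpace Ω} (hm : ∀ j, m j ≤ mΩ) {P : Measure Ω} (h : iIndep m P)
    {φ : Ω → ℝ} (hφ : IsProductDensity m P φ) {i : I} {b c : Ω → ℝ} (hb : IsDensity (m i) P b)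
    (hc : Measurable[m i] c) (hcpos : ∀ ω, 0 < c ω)
    (hcφ : IsDensity mΩ P fun ω => c ω * φ ω) {A B : Set Ω} (hA : MeasurableSet A)
    (hB : MeasurableSet B) (H : CondIndepWeights 𝒢 m P A B) :
    ∀ᵐ ω ∂P, condDet 𝒢 P (fun _ => 1) b A ω * condDet 𝒢 P φ (fun ω => c ω * φ ω) B ω = 0 := by
  classical
  have := h.isProbabilityMeasure
  have hU : ⨆ j, m j ≤ mΩ := iSup_le hm
  choose f hf hfφ using fun j => exists_condDensity (hm j) hφ.isDensity
  obtain ⟨g, hg, hgφ⟩ := exists_condDensity hU hφ.isDensity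
  have hψ := isNeutralDensity_div hU hg hφ.isDensity hgφ
  have hcf : IsDensity (m i) P fun ω => c ω * f i ω := by
    refine ⟨hc.mul (hf i).measurable, fun ω => mul_pos (hcpos ω) ((hf i).pos ω), ?_⟩
    have h1 := lintegral_mul_eq_of_tilt_eq (hm i) ((hf i).measurable.mono (hm i) le_rfl)
      hφ.measurable (hfφ i) (ENNReal.measurable_ofReal.comp hc)
    simp only [Function.comp_apply, mul_comm (ENNReal.ofReal (f i _)),
      mul_comm (ENNReal.ofReal (φ _)), ← ENNReal.ofReal_mul (hcpos _).le] at h1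
    rw [h1, hcφ.lintegral_eq]
  let ρ : Fin 2 → Finset I → Ω → ℝ := fun k K ω =>
    φ ω / g ω * (![fun _ => 1, c] k ω * ∏ j ∈ K, f j ω)
  let ρ' : Fin 2 → Ω → ℝ := fun k ω => ![fun _ => 1, c] k ω * φ ω
  have hρ' : ∀ k, Integrable (ρ' k) P := by
    intro k
    fin_cases k
    · simpa [ρ'] using hφ.integrable
    · simpa [ρ'] using hcφ.integrable le_rfl
  have hρerase : ∀ k (K : Finset I), i ∈ K → ρ k K = fun ω =>
      φ ω / g ω * (![f i, fun ω => c ω * f i ω] k ω * ∏ j ∈ K.erase i, f j ω) := by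
    intro k K hiK
    ext ω
    simp only [ρ]
    rw [← Finset.mul_prod_erase K _ hiK]
    fin_cases k
    · simp
    · simp [mul_assoc]
  have hdens : ∀ k, IsDensity (m i) P (![f i, fun ω => c ω * f i ω] k) := by
    intro k
    fin_cases k
    exacts [hf i, hcf]
  have hρ : ∀ k K, i ∈ K → Integrable (ρ k K) P := by
    intro k K hiK
    rw [hρerase k K hiK]
    exact (isProductDensity_mul_mul_prod hm h hψ hf (Finset.notMem_erase i K) (hdens k)).integrable
  have hlim : ∀ k, Tendsto (fun K => eLpNorm (ρ k K - ρ' k) 1 P) atTop (𝓝 0) := by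
    intro k
    refine tendsto_eLpNorm_neutral_mul_prod hm h hφ hf hfφ hg hgφ (i := i) ?_ (hρ' k)
    fin_cases k
    exacts [measurable_const, hc]
  have hi : ∀ᶠ K : Finset I in atTop, i ∈ K := by
    filter_upwards [eventually_ge_atTop {i}] with K hK using Finset.singleton_subset_iff.1 hK
  let T : Bool → Set Ω := fun t => if t then B else Set.univ
  have hT : ∀ t, MeasurableSet (T t) := fun t => by
    cases t
    exacts [MeasurableSet.univ, hB]
  obtain ⟨ns, hns, hae⟩ := exists_seq_tendsto_ae_of_tendsto_eLpNorm (κ := Fin 2 × Bool)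
    (u := fun k K => condWeight 𝒢 P (ρ k.1 K) (T k.2))
    (v := fun k => condWeight 𝒢 P (ρ' k.1) (T k.2))
    (fun k K => integrable_condExp.aestronglyMeasurable)
    (fun k => integrable_condExp.aestronglyMeasurable) (l := atTop)
    (fun k => by
      refine tendsto_of_tendsto_of_tendsto_of_le_of_le' tendsto_const_nhds (hlim k.1)
        (Eventually.of_forall fun _ => zero_le) ?_
      filter_upwards [hi] with K hK
      exact eLpNorm_condWeight_sub_le (hρ k.1 K hK) (hρ' k.1) (hT k.2)) hi
  have hzero : ∀ᵐ ω ∂P, ∀ n, condDet 𝒢 P (fun _ => 1) b A ω *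
      condDet 𝒢 P (ρ 0 (ns n)) (ρ 1 (ns n)) B ω = 0 := by
    rw [ae_all_iff]
    intro n
    rw [hρerase 0 _ (hns n), hρerase 1 _ (hns n)]
    exact condDet_path_eq_zero h𝒢 hm h hψ hf (Finset.notMem_erase i (ns n))
      (a := ![fun _ => 1, b, f i, fun ω => c ω * f i ω])
      (fun k => by
        fin_cases k
        exacts [IsDensity.one, hb, hf i, hcf]) hA hB H
  filter_upwards [hae, hzero] with ω h1 h2
  have h3 : Tendsto (fun n => condDet 𝒢 P (fun _ => 1) b A ω *
      condDet 𝒢 P (ρ 0 (ns n)) (ρ 1 (ns n)) B ω) atTop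
      (𝓝 (condDet 𝒢 P (fun _ => 1) b A ω * condDet 𝒢 P (ρ' 0) (ρ' 1) B ω)) :=
    (((h1 (0, true)).mul (h1 (1, false))).sub ((h1 (1, true)).mul (h1 (0, false)))).const_mul _
  simp only [h2] at h3
  have h4 := tendsto_nhds_unique h3 tendsto_const_nhds
  simpa [ρ'] using h4

end Convergence

/-! ### Translation to conditional probabilities and irrelevance -/

section Irrelevance

variable {Ω I : Type*} {V : I → Type*} {E E' F : Type*}

open scoped ENNReal

/-- The sets almost surely equal to one in the uncompleted sigma-algebra form a sigma-algebra, which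
contains the null sets. -/
theorem exists_measurable_ae_eq_of_sigma {mΩ : MeasurableSpace Ω} {μ P : Measure Ω} (hP : P ≪ μ)
    [mE : MeasurableSpace E] {X : Ω → E} {A : Set Ω} (hA : MeasurableSet[sigma μ X] A) :
    ∃ B, MeasurableSet[mE.comap X] B ∧ A =ᵐ[P] B := by
  have h : sigma μ X ≤ eventuallyMeasurableSpace (mE.comap X) (ae P) := by
    refine sup_le (fun s hs => ⟨s, hs, Filter.EventuallyEq.rfl⟩)
      (MeasurableSpace.generateFrom_le ?_)
    rintro N ⟨-, hN⟩
    exact ⟨∅, @MeasurableSet.empty _ (_), ae_eq_empty.2 (hP hN)⟩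
  exact h A hA

theorem iIndep_sigma {mΩ : MeasurableSpace Ω} {μ P : Measure Ω} (hP : P ≪ μ)
    [∀ i, MeasurableSpace (V i)] {U : (i : I) → Ω → V i} (h : iIndepFun U P) :
    iIndep (fun i => sigma μ (U i)) P := by
  classical
  rw [iIndep_iff]
  intro s A hA
  have hex : ∀ i, ∃ B : Set Ω, i ∈ s → MeasurableSet[MeasurableSpace.comap (U i) inferInstance] B ∧
      A i =ᵐ[P] B := fun i => by
    by_cases hi : i ∈ s
    · obtain ⟨B, hB⟩ := exists_measurable_ae_eq_of_sigma hP (hA i hi)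
      exact ⟨B, fun _ => hB⟩
    · exact ⟨∅, fun hi' => (hi hi').elim⟩
  choose B hB using hex
  have h1 : (⋂ i ∈ s, A i : Set Ω) =ᵐ[P] (⋂ i ∈ s, B i : Set Ω) :=
    Filter.EventuallyEq.countable_bInter s.countable_toSet fun i hi => (hB i hi).2
  rw [measure_congr h1, h.meas_biInter fun i hi => (hB i hi).1]
  exact Finset.prod_congr rfl fun i hi => (measure_congr (hB i hi).2).symm

theorem sigma_subfamily_singleton_le {mΩ : MeasurableSpace Ω} (μ : Measure Ω)
    [∀ i, MeasurableSpace (V i)] (U : (i : I) → Ω → V i) (i : I) :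
    sigma μ (subfamily U {i}) ≤ sigma μ (U i) := by
  refine sup_le_sup_right ?_ _
  rw [← measurable_iff_comap_le]
  refine @measurable_pi_lambda _ _ _ (MeasurableSpace.comap (U i) inferInstance) _ _ ?_
  rintro ⟨k, rfl : k = i⟩
  exact comap_measurable (U k)

theorem exists_pos_density {mΩ : MeasurableSpace Ω} {P Q : Measure Ω} [IsProbabilityMeasure P]
    [IsProbabilityMeasure Q] (hPQ : P ≪ Q) (hQP : Q ≪ P) :
    ∃ φ : Ω → ℝ, Measurable φ ∧ (∀ ω, 0 < φ ω) ∧ Q = tilt P φ := by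
  classical
  let r : Ω → ℝ := fun ω => (Q.rnDeriv P ω).toReal
  have hr : Measurable r := (Measure.measurable_rnDeriv Q P).ennreal_toReal
  refine ⟨fun ω => if 0 < r ω then r ω else 1,
    Measurable.ite (measurableSet_lt measurable_const hr) hr measurable_const, fun ω => ?_, ?_⟩
  · dsimp only
    split_ifs with h
    exacts [h, one_pos]
  · rw [← Measure.withDensity_rnDeriv_eq Q P hQP]
    refine withDensity_congr_ae ?_
    filter_upwards [hPQ.ae_le (Measure.rnDeriv_pos hQP), Measure.rnDeriv_lt_top Q P] with ω h0 h1
    have h2 : 0 < r ω := ENNReal.toReal_pos h0.ne' h1.ne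
    rw [if_pos h2, ENNReal.ofReal_toReal h1.ne]

theorem absolutelyContinuous_tilt {mΩ : MeasurableSpace Ω} {P : Measure Ω} {ρ : Ω → ℝ}
    (hρ : Measurable ρ) (hpos : ∀ ω, 0 < ρ ω) : P ≪ tilt P ρ :=
  withDensity_absolutelyContinuous' (by fun_prop)
    (Filter.Eventually.of_forall fun ω => by simpa using hpos ω)

theorem isDensity_of_tilt {n mΩ : MeasurableSpace Ω} {P : Measure Ω} {ρ : Ω → ℝ}
    (hρ : Measurable[n] ρ) (hpos : ∀ ω, 0 < ρ ω) [IsProbabilityMeasure (tilt P ρ)] :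
    IsDensity n P ρ := by
  refine ⟨hρ, hpos, ?_⟩
  have h1 : tilt P ρ Set.univ = 1 := measure_univ
  rwa [tilt, withDensity_apply _ MeasurableSet.univ, setLIntegral_univ] at h1

theorem IsProductDensity.tilt_mem_productMeasures {mΩ : MeasurableSpace Ω} {μ P : Measure Ω}
    [∀ i, MeasurableSpace (V i)] {U : (i : I) → Ω → V i} (hP : P ∈ productMeasures μ U)
    {ρ : Ω → ℝ} (hρ : IsProductDensity (fun i => sigma μ (U i)) P ρ) :
    tilt P ρ ∈ productMeasures μ U :=
  ⟨hρ.indep.isProbabilityMeasure, iIndep_mono hρ.indep fun _ => le_sup_left,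
    (withDensity_absolutelyContinuous P _).trans hP.2.2.1,
    hP.2.2.2.trans (absolutelyContinuous_tilt hρ.measurable hρ.pos)⟩

/-- Conditional independence under `tilt P ρ`, multiplied by the square of the conditional
expectation of `ρ`, is an identity free of quotients. -/
theorem condIndepWeights_of_condIndepGiven {mΩ : MeasurableSpace Ω} {μ P : Measure Ω}
    [∀ i, MeasurableSpace (V i)] {U : (i : I) → Ω → V i} (hP : P ∈ productMeasures μ U)
    [MeasurableSpace E] [MeasurableSpace E'] [MeasurableSpace F]
    {X : Ω → E} {Y : Ω → E'} {Z : Ω → F} (hX : Measurable X) (hY : Measurable Y)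
    (hZ : Measurable Z) (hXY : ∀ P ∈ productMeasures μ U, CondIndepGiven μ P X Y Z) {A B : Set Ω}
    (hA : MeasurableSet[sigma μ X] A) (hB : MeasurableSet[sigma μ Y] B) :
    CondIndepWeights (sigma μ Z) (fun i => sigma μ (U i)) P A B := by
  intro ρ hρ
  have := hP.1
  have hA' := sigma_le μ hX _ hA
  have hB' := sigma_le μ hY _ hB
  have h1 := (absolutelyContinuous_tilt hρ.measurable hρ.pos).ae_le
    (hXY _ (hρ.tilt_mem_productMeasures hP) A B hA hB)
  have hZ' := sigma_le μ hZ
  filter_upwards [h1, condExp_tilt_mul hZ' hρ.isDensity hA', condExp_tilt_mul hZ' hρ.isDensity hB',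
    condExp_tilt_mul hZ' hρ.isDensity (hA'.inter hB')] with ω w1 w2 w3 w4
  rw [← w2, ← w3, ← w4]
  simp only [condProb] at w1
  rw [← w1]
  ring

theorem condProb_eq_of_condDet_eq_zero {mΩ : MeasurableSpace Ω} {μ P : Measure Ω}
    [IsProbabilityMeasure P] [MeasurableSpace F] {Z : Ω → F} (hZ : Measurable Z) {ρ ρ' : Ω → ℝ}
    (hρ : IsDensity mΩ P ρ) (hρ' : IsDensity mΩ P ρ') {A : Set Ω} (hA : MeasurableSet A) :
    ∀ᵐ ω ∂P, condDet (sigma μ Z) P ρ ρ' A ω = 0 →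
      condProb μ (tilt P ρ) Z A ω = condProb μ (tilt P ρ') Z A ω := by
  have hZ' := sigma_le μ hZ
  filter_upwards [condExp_tilt_mul hZ' hρ hA, condExp_tilt_mul hZ' hρ' hA,
    condWeight_univ_pos hZ' (hρ.integrable le_rfl) hρ.pos,
    condWeight_univ_pos hZ' (hρ'.integrable le_rfl) hρ'.pos] with ω h1 h2 p1 p2 h
  rw [condDet, ← h1, ← h2] at h
  have h3 : (condProb μ (tilt P ρ) Z A ω - condProb μ (tilt P ρ') Z A ω) *
      (condWeight (sigma μ Z) P ρ Set.univ ω * condWeight (sigma μ Z) P ρ' Set.univ ω) = 0 := by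
    simp only [condProb]
    linear_combination h
  exact sub_eq_zero.1 ((mul_eq_zero.1 h3).resolve_right (mul_pos p1 p2).ne')

/-- A change of the distribution of `U i` cannot affect the conditional probabilities of events of
both `X` and `Y` at the same time. -/
theorem condProb_eq_or_condProb_eq {mΩ : MeasurableSpace Ω} {μ : Measure Ω}
    [∀ i, MeasurableSpace (V i)] {U : (i : I) → Ω → V i} (hU : ∀ i, Measurable (U i))
    [MeasurableSpace E] [MeasurableSpace E'] [MeasurableSpace F]
    {X : Ω → E} {Y : Ω → E'} {Z : Ω → F} (hX : Measurable X) (hY : Measurable Y)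
    (hZ : Measurable Z) (hXY : ∀ P ∈ productMeasures μ U, CondIndepGiven μ P X Y Z) {i : I}
    {P Q P' Q' : Measure Ω} (hPQ : (P, Q) ∈ productPairs μ U {i})
    (hPQ' : (P', Q') ∈ productPairs μ U {i}) {A B : Set Ω}
    (hA : MeasurableSet[sigma μ X] A) (hB : MeasurableSet[sigma μ Y] B) :
    ∀ᵐ ω ∂μ, condProb μ P Z A ω = condProb μ Q Z A ω ∨
      condProb μ P' Z B ω = condProb μ Q' Z B ω := by
  obtain ⟨hP, hQ, b, hbpos, hb, rfl : Q = tilt P b⟩ := hPQ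
  obtain ⟨hP', hQ', c, hcpos, hc, rfl : Q' = tilt P' c⟩ := hPQ'
  dsimp only at hP hQ hP' hQ'
  have := hP.1
  have := hQ.1
  have := hP'.1
  have := hQ'.1
  let m : I → MeasurableSpace Ω := fun j => sigma μ (U j)
  have hm : ∀ j, m j ≤ mΩ := fun j => sigma_le μ (hU j)
  have hbm : Measurable[m i] b := hb.mono (sigma_subfamily_singleton_le μ U i) le_rfl
  have hcm : Measurable[m i] c := hc.mono (sigma_subfamily_singleton_le μ U i) le_rfl
  have hcΩ : Measurable c := hcm.mono (hm i) le_rfl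
  -- The two pairs are unrelated; equivalence of `P` and `P'` expresses all four measures by
  -- densities relative to `P`.
  obtain ⟨φ, hφm, hφpos, rfl⟩ := exists_pos_density (hP.2.2.1.trans hP'.2.2.2)
    (hP'.2.2.1.trans hP.2.2.2)
  have hφ : IsProductDensity m P φ := ⟨hφm, hφpos, iIndep_sigma hP'.2.2.1 hP'.2.1⟩
  have hcφ : tilt (tilt P φ) c = tilt P fun ω => c ω * φ ω := by
    rw [tilt, tilt, ← withDensity_mul _ (by fun_prop) (by fun_prop)]
    congr 1
    ext ω
    rw [Pi.mul_apply, ← ENNReal.ofReal_mul (hφpos ω).le, mul_comm]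
  rw [hcφ] at hQ' ⊢
  have := hQ'.1
  have hdb : IsDensity (m i) P b := isDensity_of_tilt hbm hbpos
  have hdb' : IsDensity mΩ P b := isDensity_of_tilt (hbm.mono (hm i) le_rfl) hbpos
  have hdc : IsDensity mΩ P fun ω => c ω * φ ω :=
    isDensity_of_tilt (hcΩ.mul hφm) fun ω => mul_pos (hcpos ω) (hφpos ω)
  have hA' := sigma_le μ hX _ hA
  have hB' := sigma_le μ hY _ hB
  have h1 : tilt P (fun _ => 1) = P := by simp [tilt]
  refine hP.2.2.2.ae_le ?_
  filter_upwards [condDet_mul_condDet_productDensity_eq_zero (sigma_le μ hZ) hm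
      (iIndep_sigma hP.2.2.1 hP.2.1) hφ hdb hcm hcpos hdc hA' hB'
      (condIndepWeights_of_condIndepGiven hP hX hY hZ hXY hA hB),
    condProb_eq_of_condDet_eq_zero (μ := μ) hZ (IsDensity.one (n := mΩ) (P := P)) hdb' hA',
    condProb_eq_of_condDet_eq_zero (μ := μ) hZ hφ.isDensity hdc hB'] with ω w1 w2 w3
  rw [h1] at w2
  exact (mul_eq_zero.1 w1).imp w2 w3

/-- The event that a change of the distribution of one `U i` affects the conditional probability
of an event of `X` given `Z`; the parameter ranges over the changes and events. -/
def affectedSet {mΩ : MeasurableSpace Ω} (μ : Measure Ω) [∀ i, MeasurableSpace (V i)]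
    (U : (i : I) → Ω → V i) [MeasurableSpace E] [MeasurableSpace F] (X : Ω → E) (Z : Ω → F) (i : I)
    (t : {t : (Measure Ω × Measure Ω) × Set Ω //
      t.1 ∈ productPairs μ U {i} ∧ MeasurableSet[sigma μ X] t.2}) : Set Ω :=
  {ω | condProb μ t.1.1.1 Z t.1.2 ω ≠ condProb μ t.1.1.2 Z t.1.2 ω}

theorem measurableSet_affectedSet {mΩ : MeasurableSpace Ω} (μ : Measure Ω)
    [∀ i, MeasurableSpace (V i)] (U : (i : I) → Ω → V i) [MeasurableSpace E] [MeasurableSpace F]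
    (X : Ω → E) (Z : Ω → F) (i : I) (t) :
    MeasurableSet[sigma μ Z] (affectedSet μ U X Z i t) := by
  have h : ∀ P : Measure Ω, Measurable[sigma μ Z] (condProb μ P Z t.1.2) := fun P =>
    stronglyMeasurable_condExp.measurable
  exact @MeasurableSet.compl _ _ (sigma μ Z) (measurableSet_eq_fun (h _) (h _))

/-- An event of `Z` that contains all affected events up to null sets has its complement in the
event that `i` is in the index set of irrelevance, up to null sets. -/
theorem IsIrrelevance.asSubset_compl {mΩ : MeasurableSpace Ω} {μ : Measure Ω}
    [∀ i, MeasurableSpace (V i)] {U : (i : I) → Ω → V i} [MeasurableSpace E] [MeasurableSpace F]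
    {X : Ω → E} {Z : Ω → F} {J : Ω → Set I} (hJ : IsIrrelevance μ U X Z J) {i : I} {D : Set Ω}
    (hD : MeasurableSet[sigma μ Z] D) (hsub : ∀ t, AsSubset μ (affectedSet μ U X Z i t) D) :
    AsSubset μ Dᶜ {ω | i ∈ J ω} := by
  classical
  -- The witness is the index set `{i}` off `D` and `∅` on `D`.
  have hirr : IsIrrelevant μ U X Z fun ω => {j | j = i ∧ ω ∉ D} := by
    refine ⟨?_, ?_⟩
    · refine (@measurable_set_iff _ _ (sigma μ Z) _).2 fun j => ?_
      refine (@measurableSet_setOfPred _ (sigma μ Z) _).1 ?_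
      by_cases hj : j = i
      · simpa [hj, Set.compl_def] using hD.compl
      · simp [hj]
    · rintro j P Q hPQ A hA
      by_cases hj : j = i
      · subst hj
        have h1 : ∀ᵐ ω ∂μ, ω ∉ affectedSet μ U X Z j ⟨((P, Q), A), hPQ, hA⟩ \ D :=
          measure_eq_zero_iff_ae_notMem.1 (hsub ⟨((P, Q), A), hPQ, hA⟩)
        filter_upwards [h1] with ω hω hωD
        by_contra hne
        exact hω ⟨hne, hωD.2⟩
      · exact Filter.Eventually.of_forall fun ω hω => (hj hω.1).elim
  have h := (hJ i).subset ⟨_, hirr⟩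
  convert h using 1
  ext ω
  simp

/-- The union must be an event of `Z` for its complement to define an admissible index set, hence it
is formed in `σ(Z)` with the trimmed measure. -/
theorem exists_isAsUnion_affectedSet {mΩ : MeasurableSpace Ω} (μ : Measure Ω) [IsFiniteMeasure μ]
    [∀ i, MeasurableSpace (V i)] (U : (i : I) → Ω → V i) [MeasurableSpace E] [MeasurableSpace F]
    (X : Ω → E) {Z : Ω → F} (hZ : Measurable Z) (i : I) :
    ∃ D, MeasurableSet[sigma μ Z] D ∧ (∀ t, AsSubset μ (affectedSet μ U X Z i t) D) ∧
      ∀ C, MeasurableSet[sigma μ Z] C → (∀ t, AsSubset μ (affectedSet μ U X Z i t) C) →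
        AsSubset μ D C := by
  have hle := sigma_le μ hZ
  have hm := measurableSet_affectedSet μ U X Z i
  obtain ⟨D, hD, hsub, hmin⟩ := @exists_isAsUnion _ (sigma μ Z) (μ.trim hle) _ _
    (affectedSet μ U X Z i) hm
  have htrim : ∀ S T, MeasurableSet[sigma μ Z] S → MeasurableSet[sigma μ Z] T →
      (@AsSubset _ (sigma μ Z) (μ.trim hle) S T ↔ AsSubset μ S T) := fun S T hS hT => by
    simp only [AsSubset]
    rw [trim_measurableSet_eq hle (@MeasurableSet.diff _ (sigma μ Z) _ _ hS hT)]
  exact ⟨D, hD, fun t => (htrim _ _ (hm t) hD).1 (hsub t), fun C hC hC' =>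
    (htrim _ _ hD hC).1 (hmin C hC fun t => (htrim _ _ (hm t) hC).2 (hC' t))⟩

end Irrelevance

end StructuralIndependence

/-! ### The theorem -/

theorem theorem8p2p2
    {Ω : Type*} [MeasurableSpace Ω] (μ : Measure Ω) [IsProbabilityMeasure μ]
    {I : Type*} {V : I → Type*} [∀ i, MeasurableSpace (V i)]
    (U : (i : I) → Ω → V i) (hU : ∀ i, Measurable (U i))
    {E E' F : Type*} [MeasurableSpace E] [MeasurableSpace E'] [MeasurableSpace F]
    (X : Ω → E) (Y : Ω → E') (Z : Ω → F)
    (hX : Measurable X) (hY : Measurable Y) (hZ : Measurable Z)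
    (hXY : ∀ P ∈ StructuralIndependence.productMeasures μ U,
      StructuralIndependence.CondIndepGiven μ P X Y Z)
    (JX JY : Ω → Set I)
    (hJX : StructuralIndependence.IsIrrelevance μ U X Z JX)
    (hJY : StructuralIndependence.IsIrrelevance μ U Y Z JY) :
    StructuralIndependence.AsEqIndex μ (fun ω => JX ω ∪ JY ω) (fun _ => Set.univ) := by
  refine ⟨fun i => by simp [StructuralIndependence.AsSubset], fun i => ?_⟩
  obtain ⟨DX, hDX, hsubX, hminX⟩ :=
    StructuralIndependence.exists_isAsUnion_affectedSet μ U X hZ i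
  obtain ⟨DY, hDY, hsubY, hminY⟩ :=
    StructuralIndependence.exists_isAsUnion_affectedSet μ U Y hZ i
  have hdisj : ∀ t s, μ (StructuralIndependence.affectedSet μ U X Z i t ∩
      StructuralIndependence.affectedSet μ U Y Z i s) = 0 := by
    intro t s
    rw [measure_eq_zero_iff_ae_notMem]
    filter_upwards [StructuralIndependence.condProb_eq_or_condProb_eq hU hX hY hZ hXY t.2.1 s.2.1
      t.2.2 s.2.2] with ω hω hmem
    exact hω.elim hmem.1 hmem.2
  -- Minimality is used twice: pairwise disjointness of affected sets passes first to `DX` against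
  -- each affected set of `Y`, then to `DY` against `DX`.
  have hDXs : ∀ s, StructuralIndependence.AsSubset μ DX
      (StructuralIndependence.affectedSet μ U Y Z i s)ᶜ := fun s =>
    hminX _ (StructuralIndependence.measurableSet_affectedSet μ U Y Z i s).compl fun t => by
      rw [StructuralIndependence.AsSubset, Set.sdiff_compl]
      exact hdisj t s
  have hDYX : StructuralIndependence.AsSubset μ DY DXᶜ := hminY _ hDX.compl fun s => by
    have h := hDXs s
    rw [StructuralIndependence.AsSubset, Set.sdiff_compl] at h ⊢
    rwa [Set.inter_comm]
  have hX' := hJX.asSubset_compl hDX hsubX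
  have hY' := hJY.asSubset_compl hDY hsubY
  unfold StructuralIndependence.AsSubset at hDYX hX' hY' ⊢
  refine measure_mono_null ?_ (measure_union_null hDYX (measure_union_null hX' hY'))
  intro ω hω
  simp only [Set.mem_sdiff, Set.mem_ofPred_eq, Set.mem_univ, Set.mem_union, Set.mem_compl_iff,
    not_not, true_and, not_or] at hω ⊢
  tauto
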